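/- Conventions. A \emph{Hilbert–Hadamard space} is a complete geodesic CAT(0) metric space $M$ all of whose tangent cones $T_xM$ embed isometrically into real Hilbert spaces. Here $T_xM$ is the Euclidean cone over the space of directions at $x$ (classes of nontrivial geodesic segments emanating from $x$, with the Alexandrov angle as distance). The \emph{tangent Hilbert space} $\mathcal H_xM$ is the real Hilbert space spanned by $T_xM$ with the tip as origin: the completion of the space of finite formal real linear combinations of points of $T_xM$ with coefficient sum zero under $\langle\sum a_v v,\sum b_w w\rangle=-\tfrac12\sum a_vb_w\,d(v,w)^2$, with $v\in T_xM$ identified with $v-\text{tip}$. For $x,y\in M$ let $\log_x(y)=[([x,y],d(x,y))]\in T_xM\subset\mathcal H_xM$. For a real Hilbert space $H$, let $\operatorname{Cliff}_{\mathbb C}(H)$ be its complex Clifford $C^*$-algebra, generated by $H$, with vectors self-adjoint and $\xi^2=\|\xi\|^2$. Put $t\mathbb R=\mathbb R$ for $t>0$ and $0\,\mathbb R=\{0\}$, and let $\Pi_b(M)$ be the $C^*$-algebra of all bounded elements of $\prod_{(x,t)\in M\times[0,\infty)}\operatorname{Cliff}_{\mathbb C}(\mathcal H_xM\oplus t\mathbb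 R)$, with pointwise operations and the supremum norm. For $x_0\in M$ put $C_{x_0}(x,t)=(-\log_x(x_0),t)$, and let the \emph{Bott homomorphism} $\beta_{x_0}\colon C_0(\mathbb R)\to\Pi_b(M)$ be given by functional calculus: $\beta_{x_0}(f)(x,t)=f(C_{x_0}(x,t))$. Let $\mathcal A(M)$ be the $C^*$-subalgebra of $\Pi_b(M)$ generated by all $\beta_{x_0}(f)$ with $x_0\in M$ and $f\in C_0(\mathbb R)$, and $\mathcal A_{ev}(M)$ the $C^*$-subalgebra generated by those with $f$ even. An isometry $\varphi$ of $M$ (onto itself) has derivatives $D_x\varphi\colon T_xM\to T_{\varphi(x)}M$, $[(\alpha,t)]\mapsto[(\varphi\circ\alpha,t)]$, which extend to isometric linear isomorphisms $\mathcal H(D_x\varphi)\colon\mathcal H_xM\to\mathcal H_{\varphi(x)}M$; it acts on $\Pi_b(M)$ by $\varphi_*(\sigma)(x,t)=\operatorname{Cliff}_{\mathbb C}\bigl(\mathcal H(D_{\varphi^{-1}(x)}\varphi)\oplus\mathrm{id}_{t\mathbb R}\bigr)\bigl(\sigma(\varphi^{-1}(x),t)\bigr)$. For a commutative $C^*$-algebra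 $B$, $\widehat B$ is its space of characters with the topology of pointwise convergence. For a discrete group $\Gamma$ and a locally compact Hausdorff space $X$ on which $\Gamma$ acts by homeomorphisms, a \emph{$\Gamma$-$X$-$C^*$-algebra} is a $C^*$-algebra $B$ on which $\Gamma$ acts by $*$-automorphisms, together with a continuous $\Gamma$-equivariant map $\widehat{Z(B)}\to X$, where $Z(B)$ is the center of $B$. It is \emph{proper} if for every compact $K\subset X$ one has $K\cap\gamma K=\varnothing$ for all but finitely many $\gamma\in\Gamma$. Statement. Let $\Gamma$ be a discrete group acting by isometries on a Hilbert–Hadamard space $M$ through $\alpha\colon\Gamma\to\operatorname{Isom}(M)$, and suppose that the action is metrically proper, i.e. $d(x,\alpha_\gamma(x))\to\infty$ as $\gamma\to\infty$, for all $x\in M$. Then the automorphisms $(\alpha_\gamma)_*$ of $\Pi_b(M)$ restrict to actions of $\Gamma$ by $*$-automorphisms on $\mathcal A(M)$ and on $\mathcal A_{ev}(M)$; the algebra $\mathcal A_{ev}(M)$ is contained in the center of $\mathcal A(M)$, the linear span of $\mathcal A_{ev}(M)\cdot\mathcal A(M)$ is dense in $\mathcal A(M)$, and every character of $Z(\mathcal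 A(M))$ restricts to a character of $\mathcal A_{ev}(M)$; and with the induced actions and the restriction map $\widehat{Z(\mathcal A(M))}\to\widehat{\mathcal A_{ev}(M)}$, the algebra $\mathcal A(M)$ is a proper $\Gamma$-$\widehat{\mathcal A_{ev}(M)}$-$C^*$-algebra. That is, $\widehat{\mathcal A_{ev}(M)}$ is locally compact and Hausdorff, the restriction map is continuous and $\Gamma$-equivariant, and $\Gamma$ acts properly on $\widehat{\mathcal A_{ev}(M)}$ by $(\gamma\cdot\chi)(a)=\chi((\alpha_\gamma)_*^{-1}(a))$. -/

import Mathlib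

open Filter Topology UniformSpace ComplexConjugate
open scoped ENNReal NNReal InnerProductSpace ZeroAtInfty

noncomputable section

namespace HilbertHadamard

/-! ## Hilbert spaces spanned by positive semidefinite kernels -/

section Kernel

/-- A Hermitian positive semidefinite kernel on a set `X`. -/
structure PSDKernel (𝕜 : Type*) [RCLike 𝕜] (X : Type*) where
  /-- the values of the kernel -/
  val : X → X → 𝕜
  conj_symm : ∀ x y, conj (val y x) = val x y
  nonneg : ∀ c : X →₀ 𝕜,
    0 ≤ RCLike.re (c.sum fun x a => c.sum fun y b => conj a * b * val x y)

variable {𝕜 : Type*} [RCLike 𝕜] {X Y Z : Type*}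

/-- Finite formal linear combinations of points of `X`, to be equipped with the semi-inner
product determined by the kernel `K`. -/
def PreKernelSpace (_K : PSDKernel 𝕜 X) : Type _ := X →₀ 𝕜

variable (K : PSDKernel 𝕜 X) (L : PSDKernel 𝕜 Y)

instance : AddCommGroup (PreKernelSpace K) := inferInstanceAs (AddCommGroup (X →₀ 𝕜))
instance : Module 𝕜 (PreKernelSpace K) := inferInstanceAs (Module 𝕜 (X →₀ 𝕜))

/-- `⟨∑ aₓ x, ∑ b_y y⟩ = ∑ conj aₓ * b_y * K x y`. -/
abbrev finsuppCore : PreInnerProductSpace.Core 𝕜 (X →₀ 𝕜) where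
  inner c d := c.sum fun x a => d.sum fun y b => conj a * b * K.val x y
  conj_inner_symm c d := by
    rw [Finsupp.sum_comm]
    simp only [map_finsuppSum]
    congr! 4 with x a
    funext y b
    rw [← K.conj_symm x y]
    simp only [map_mul, RCLike.conj_conj]
    ring
  re_inner_nonneg c := K.nonneg c
  add_left c d e := by
    rw [Finsupp.sum_add_index'] <;> simp [← Finsupp.sum_add, add_mul]
  smul_left c d r := by
    rw [Finsupp.sum_smul_index] <;> simp [Finsupp.mul_sum, ← mul_assoc]

instance preCore : PreInnerProductSpace.Core 𝕜 (PreKernelSpace K) := finsuppCore K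

instance : SeminormedAddCommGroup (PreKernelSpace K) :=
  InnerProductSpace.Core.toSeminormedAddCommGroup (𝕜 := 𝕜)

instance : InnerProductSpace 𝕜 (PreKernelSpace K) := InnerProductSpace.ofCore _

/-- The formal linear combination `1 · x`. -/
def PreKernelSpace.single (x : X) : PreKernelSpace K := Finsupp.single x (1 : 𝕜)

theorem PreKernelSpace.inner_def (c d : PreKernelSpace K) :
    inner 𝕜 c d
      = Finsupp.sum c fun x a => Finsupp.sum d fun y b => conj a * b * K.val x y := rfl

theorem PreKernelSpace.inner_single (x y : X) :
    inner 𝕜 (PreKernelSpace.single K x) (PreKernelSpace.single K y) = K.val x y := by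
  change ((Finsupp.single x (1 : 𝕜)).sum fun x a =>
    (Finsupp.single y (1 : 𝕜)).sum fun y b => conj a * b * K.val x y) = _
  simp

theorem PreKernelSpace.induction {p : PreKernelSpace K → Prop} (c : PreKernelSpace K)
    (h0 : p 0) (hadd : ∀ a b, p a → p b → p (a + b))
    (hs : ∀ x (a : 𝕜), p (a • PreKernelSpace.single K x)) : p c := by
  refine Finsupp.induction_linear (motive := p) c h0 hadd ?_
  intro x a
  have h : (Finsupp.single x a : X →₀ 𝕜) = a • Finsupp.single x (1 : 𝕜) := by simp
  exact h ▸ hs x a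

/-- The linear map between spaces of formal linear combinations given by its values on points. -/
def PreKernelSpace.lift {V : Type*} [AddCommGroup V] [Module 𝕜 V] (f : X → V) :
    PreKernelSpace K →ₗ[𝕜] V :=
  Finsupp.linearCombination 𝕜 f

@[simp] theorem PreKernelSpace.lift_single {V : Type*} [AddCommGroup V] [Module 𝕜 V] (f : X → V)
    (x : X) : PreKernelSpace.lift K f (PreKernelSpace.single K x) = f x := by
  exact (Finsupp.linearCombination_single 𝕜 (1 : 𝕜) x).trans (one_smul _ _)

theorem PreKernelSpace.hom_ext {V : Type*} [AddCommGroup V] [Module 𝕜 V]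
    {f g : PreKernelSpace K →ₗ[𝕜] V}
    (h : ∀ x, f (PreKernelSpace.single K x) = g (PreKernelSpace.single K x)) : f = g := by
  refine LinearMap.ext fun c => ?_
  induction c using PreKernelSpace.induction K with
  | h0 => simp
  | hadd a b ha hb => simp [ha, hb]
  | hs x a => simp [h]

/-- Two sesquilinear expressions agree if they agree on points. -/
theorem PreKernelSpace.inner_eq {V W : Type*} [SeminormedAddCommGroup V] [InnerProductSpace 𝕜 V]
    [SeminormedAddCommGroup W] [InnerProductSpace 𝕜 W]
    (f : PreKernelSpace K →ₗ[𝕜] V) (g : PreKernelSpace L →ₗ[𝕜] V)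
    (f' : PreKernelSpace K →ₗ[𝕜] W) (g' : PreKernelSpace L →ₗ[𝕜] W)
    (h : ∀ x y, inner 𝕜 (f (.single K x)) (g (.single L y))
      = inner 𝕜 (f' (.single K x)) (g' (.single L y))) (c : PreKernelSpace K)
    (d : PreKernelSpace L) : inner 𝕜 (f c) (g d) = inner 𝕜 (f' c) (g' d) := by
  induction c using PreKernelSpace.induction K with
  | h0 => simp
  | hadd a b ha hb => simp [inner_add_left, ha, hb]
  | hs x a =>
    induction d using PreKernelSpace.induction L with
    | h0 => simp
    | hadd d e hd he => rw [map_add, map_add, inner_add_right, inner_add_right, hd, he]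
    | hs y b =>
      simp only [map_smul, inner_smul_left, inner_smul_right, h]

/-- The Hilbert space spanned by a positive semidefinite kernel: the separated completion of the
space of formal linear combinations. -/
def KernelSpace : Type _ := Completion (PreKernelSpace K)

instance : NormedAddCommGroup (KernelSpace K) :=
  inferInstanceAs (NormedAddCommGroup (Completion (PreKernelSpace K)))
instance : InnerProductSpace 𝕜 (KernelSpace K) :=
  inferInstanceAs (InnerProductSpace 𝕜 (Completion (PreKernelSpace K)))
instance : CompleteSpace (KernelSpace K) :=
  inferInstanceAs (CompleteSpace (Completion (PreKernelSpace K)))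

/-- The canonical map from formal linear combinations to the Hilbert space. -/
def KernelSpace.mk : PreKernelSpace K →ₗᵢ[𝕜] KernelSpace K := Completion.toComplₗᵢ

theorem KernelSpace.denseRange_mk : DenseRange (KernelSpace.mk K) :=
  Completion.denseRange_coe

/-- The canonical vector `δₓ` attached to a point, with `⟨δₓ, δ_y⟩ = K x y`. -/
def KernelSpace.point (x : X) : KernelSpace K := KernelSpace.mk K (.single K x)

theorem KernelSpace.inner_point (x y : X) :
    inner 𝕜 (KernelSpace.point K x) (KernelSpace.point K y) = K.val x y := by
  rw [KernelSpace.point, KernelSpace.point, LinearIsometry.inner_map_map,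
    PreKernelSpace.inner_single]

/-- Continuous linear maps agree if they agree on points. -/
theorem KernelSpace.hom_ext {V : Type*} [NormedAddCommGroup V] [NormedSpace 𝕜 V]
    {f g : KernelSpace K →L[𝕜] V}
    (h : ∀ x, f (KernelSpace.point K x) = g (KernelSpace.point K x)) : f = g := by
  have h1 : f.toLinearMap ∘ₗ (KernelSpace.mk K).toLinearMap
      = g.toLinearMap ∘ₗ (KernelSpace.mk K).toLinearMap := PreKernelSpace.hom_ext K h
  refine DFunLike.coe_injective ?_
  exact (KernelSpace.denseRange_mk K).equalizer f.continuous g.continuous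
    (funext fun c => congrArg (fun l => l c) h1)

/-- Extension of a bounded map on formal linear combinations to the spanned Hilbert space. -/
def KernelSpace.extend (T : PreKernelSpace K →ₗ[𝕜] PreKernelSpace L) (C : ℝ)
    (hT : ∀ c, ‖T c‖ ≤ C * ‖c‖) : KernelSpace K →L[𝕜] KernelSpace L :=
  (T.mkContinuous C hT).completion

theorem KernelSpace.extend_mk (T : PreKernelSpace K →ₗ[𝕜] PreKernelSpace L) (C : ℝ)
    (hT : ∀ c, ‖T c‖ ≤ C * ‖c‖) (c : PreKernelSpace K) :
    KernelSpace.extend K L T C hT (KernelSpace.mk K c) = KernelSpace.mk L (T c) :=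
  ContinuousLinearMap.completion_apply_coe (T.mkContinuous C hT) c

theorem KernelSpace.norm_lift_eq (f : X → Y) (h : ∀ x y, L.val (f x) (f y) = K.val x y)
    (c : PreKernelSpace K) :
    ‖PreKernelSpace.lift K (fun x => PreKernelSpace.single L (f x)) c‖ = ‖c‖ := by
  have := PreKernelSpace.inner_eq K K
    (PreKernelSpace.lift K (fun x => PreKernelSpace.single L (f x)))
    (PreKernelSpace.lift K (fun x => PreKernelSpace.single L (f x)))
    LinearMap.id LinearMap.id
    (by intro x y; simp [PreKernelSpace.inner_single, h]) c c
  rw [@norm_eq_sqrt_re_inner 𝕜, @norm_eq_sqrt_re_inner 𝕜, this]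
  rfl

/-- Functoriality: the bounded linear map sending `δₓ` to `δ_{f x}`, for a map of sets `f` that
preserves the kernels. -/
def KernelSpace.mapL (f : X → Y) (h : ∀ x y, L.val (f x) (f y) = K.val x y) :
    KernelSpace K →L[𝕜] KernelSpace L :=
  KernelSpace.extend K L (PreKernelSpace.lift K fun x => PreKernelSpace.single L (f x)) 1
    (fun c => by rw [KernelSpace.norm_lift_eq K L f h, one_mul])

theorem KernelSpace.mapL_point (f : X → Y) (h : ∀ x y, L.val (f x) (f y) = K.val x y) (x : X) :
    KernelSpace.mapL K L f h (KernelSpace.point K x) = KernelSpace.point L (f x) := by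
  rw [KernelSpace.mapL, KernelSpace.point, KernelSpace.extend_mk, PreKernelSpace.lift_single]
  rfl

theorem KernelSpace.norm_mapL (f : X → Y) (h : ∀ x y, L.val (f x) (f y) = K.val x y)
    (v : KernelSpace K) : ‖KernelSpace.mapL K L f h v‖ = ‖v‖ := by
  refine (KernelSpace.denseRange_mk K).induction_on v
    (isClosed_eq (by fun_prop) (by fun_prop)) fun c => ?_
  rw [KernelSpace.mapL, KernelSpace.extend_mk, LinearIsometry.norm_map, LinearIsometry.norm_map,
    KernelSpace.norm_lift_eq K L f h]

/-- Functoriality: the unitary sending `δₓ` to `δ_{f x}`, for a bijection `f` that preserves the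
kernels. -/
def KernelSpace.map (f : X ≃ Y) (h : ∀ x y, L.val (f x) (f y) = K.val x y) :
    KernelSpace K ≃ₗᵢ[𝕜] KernelSpace L where
  toLinearEquiv := LinearEquiv.ofLinearMap (KernelSpace.mapL K L f h).toLinearMap
    (KernelSpace.mapL L K f.symm
      (fun x y => by rw [← h, f.apply_symm_apply, f.apply_symm_apply])).toLinearMap
    (by
      refine congrArg ContinuousLinearMap.toLinearMap (?_ : ContinuousLinearMap.comp
        (KernelSpace.mapL K L f h) (KernelSpace.mapL L K f.symm _) = ContinuousLinearMap.id 𝕜 _)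
      refine KernelSpace.hom_ext L fun y => ?_
      simp [KernelSpace.mapL_point])
    (by
      refine congrArg ContinuousLinearMap.toLinearMap (?_ : ContinuousLinearMap.comp
        (KernelSpace.mapL L K f.symm _) (KernelSpace.mapL K L f h) = ContinuousLinearMap.id 𝕜 _)
      refine KernelSpace.hom_ext K fun y => ?_
      simp [KernelSpace.mapL_point])
  norm_map' v := KernelSpace.norm_mapL K L f h v

theorem KernelSpace.map_point (f : X ≃ Y) (h : ∀ x y, L.val (f x) (f y) = K.val x y) (x : X) :
    KernelSpace.map K L f h (KernelSpace.point K x) = KernelSpace.point L (f x) :=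
  KernelSpace.mapL_point K L f h x

end Kernel

/-! ## The antisymmetric Fock space and the Clifford algebra -/

section Fock

variable (H : Type*) [NormedAddCommGroup H] [InnerProductSpace ℝ H]
variable {H' : Type*} [NormedAddCommGroup H'] [InnerProductSpace ℝ H']

/-- Finite tuples `(ξ₁, …, ξ_k)` of vectors, standing for `ξ₁ ∧ ⋯ ∧ ξ_k`. -/
@[ext]
structure Wedge where
  /-- the degree `k` -/
  deg : ℕ
  /-- the vectors -/
  vec : Fin deg → H

variable {H}

/-- The inner product `⟨ξ₁ ∧ ⋯ ∧ ξ_k, η₁ ∧ ⋯ ∧ η_l⟩`: the determinant of the matrix of inner products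
if `k = l`, and zero otherwise. -/
def wedgeInner (p q : Wedge H) : ℝ :=
  if h : p.deg = q.deg then
    (Matrix.of fun i j : Fin p.deg => ⟪p.vec i, q.vec (Fin.cast h j)⟫_ℝ).det
  else 0

theorem wedgeInner_mk {k : ℕ} (v w : Fin k → H) :
    wedgeInner ⟨k, v⟩ ⟨k, w⟩ = (Matrix.of fun i j : Fin k => ⟪v i, w j⟫_ℝ).det := by
  simp [wedgeInner]

theorem wedgeInner_mk_ne {k l : ℕ} (h : k ≠ l) (v : Fin k → H) (w : Fin l → H) :
    wedgeInner ⟨k, v⟩ ⟨l, w⟩ = 0 := by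
  simp [wedgeInner, h]

theorem wedgeInner_symm (p q : Wedge H) : wedgeInner p q = wedgeInner q p := by
  obtain ⟨k, v⟩ := p
  obtain ⟨l, w⟩ := q
  by_cases h : k = l
  · subst h
    rw [wedgeInner_mk, wedgeInner_mk, ← Matrix.det_transpose]
    congr 1
    ext i j
    exact real_inner_comm _ _
  · rw [wedgeInner_mk_ne h, wedgeInner_mk_ne (Ne.symm h)]

theorem wedgeInner_nonneg_of_model (s : Finset (Wedge H)) (a : Wedge H → ℝ) (E : ℕ → Type*)
    [∀ n, NormedAddCommGroup (E n)] [∀ n, InnerProductSpace ℝ (E n)]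
    (U : ∀ n, (Fin n → H) → E n)
    (hU : ∀ n (v w : Fin n → H), (⟨n, v⟩ : Wedge H) ∈ s → (⟨n, w⟩ : Wedge H) ∈ s →
      ⟪U n v, U n w⟫_ℝ = (Matrix.of fun i j : Fin n => ⟪v i, w j⟫_ℝ).det) :
    0 ≤ ∑ p ∈ s, ∑ q ∈ s, a p * a q * wedgeInner p q := by
  classical
  let u : (n : ℕ) → Wedge H → E n := fun n p =>
    if h : p.deg = n then U n (fun i => p.vec (Fin.cast h.symm i)) else 0
  have key : ∀ p ∈ s, ∀ q ∈ s, wedgeInner p q = ∑ n ∈ s.image Wedge.deg, ⟪u n p, u n q⟫_ℝ := by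
    rintro ⟨k, v⟩ hp ⟨l, w⟩ hq
    have hk : k ∈ s.image Wedge.deg := Finset.mem_image_of_mem Wedge.deg hp
    rw [Finset.sum_eq_single_of_mem k hk]
    · by_cases h : k = l
      · subst h
        simp only [u, dif_pos]
        rw [wedgeInner_mk]
        exact (hU k v w hp hq).symm
      · rw [wedgeInner_mk_ne h]
        simp [u, Ne.symm h]
    · intro n _ hn
      simp [u, Ne.symm hn]
  have : ∑ p ∈ s, ∑ q ∈ s, a p * a q * wedgeInner p q
      = ∑ n ∈ s.image Wedge.deg, ⟪∑ p ∈ s, a p • u n p, ∑ q ∈ s, a q • u n q⟫_ℝ := by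
    simp only [sum_inner, inner_sum, real_inner_smul_left, real_inner_smul_right]
    rw [Finset.sum_comm (s := s.image Wedge.deg)]
    refine Finset.sum_congr rfl fun p hp => ?_
    rw [Finset.sum_comm]
    refine Finset.sum_congr rfl fun q hq => ?_
    rw [key p hp q hq, Finset.mul_sum]
    refine Finset.sum_congr rfl fun n _ => ?_
    rw [real_inner_comm (u n p) (u n q)]
    ring
  rw [this]
  exact Finset.sum_nonneg fun n _ => real_inner_self_nonneg

theorem wedgeInner_nonneg (s : Finset (Wedge H)) (a : Wedge H → ℝ) :
    0 ≤ ∑ p ∈ s, ∑ q ∈ s, a p * a q * wedgeInner p q := by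
  let S : Set H := ⋃ p ∈ s, Set.range p.vec
  have hS : S.Finite := s.finite_toSet.biUnion fun p _ => Set.finite_range _
  let F : Submodule ℝ H := Submodule.span ℝ S
  have : FiniteDimensional ℝ F := FiniteDimensional.span_of_finite ℝ hS
  have hmem : ∀ p ∈ s, ∀ i, p.vec i ∈ F := fun p hp i =>
    Submodule.subset_span (Set.mem_biUnion hp ⟨i, rfl⟩)
  let P : H → F := fun v => F.orthogonalProjectionOnto v
  have hP : ∀ v ∈ F, ((P v : F) : H) = v := fun v hv =>
    F.starProjection_eq_self_iff.mpr hv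
  refine wedgeInner_nonneg_of_model s a (fun n => ⋀[ℝ]^n F)
    (fun n v => exteriorPower.ιMulti ℝ n fun i => P (v i)) ?_
  intro n v w hp hq
  rw [exteriorPower.inner_ιMulti_ιMulti, ← Matrix.det_transpose]
  congr 1
  ext i j
  simp only [Matrix.transpose_apply, Matrix.of_apply, Submodule.coe_inner]
  rw [hP _ (hmem _ hp i), hP _ (hmem _ hq j)]

variable (H) in
/-- The complex-valued kernel given by the inner products of decomposable wedges. -/
def wedgeKernel : PSDKernel ℂ (Wedge H) where
  val p q := (wedgeInner p q : ℂ)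
  conj_symm p q := by rw [Complex.conj_ofReal, wedgeInner_symm]
  nonneg c := by
    have h1 := wedgeInner_nonneg c.support fun p => (c p).re
    have h2 := wedgeInner_nonneg c.support fun p => (c p).im
    have : RCLike.re (c.sum fun x a => c.sum fun y b => conj a * b * (wedgeInner x y : ℂ))
        = (∑ p ∈ c.support, ∑ q ∈ c.support, (c p).re * (c q).re * wedgeInner p q)
          + ∑ p ∈ c.support, ∑ q ∈ c.support, (c p).im * (c q).im * wedgeInner p q := by
      simp only [Finsupp.sum, map_sum, ← Finset.sum_add_distrib]
      refine Finset.sum_congr rfl fun p _ => Finset.sum_congr rfl fun q _ => ?_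
      simp
      ring
    rw [this]
    exact add_nonneg h1 h2

variable (H) in
/-- The antisymmetric Fock space `⨁ₖ Λᵏ H_ℂ`: the complex Hilbert space spanned by the decomposable
wedges `ξ₁ ∧ ⋯ ∧ ξ_k`, `k ≥ 0`. -/
def Fock : Type _ := KernelSpace (wedgeKernel H)

instance : NormedAddCommGroup (Fock H) :=
  inferInstanceAs (NormedAddCommGroup (KernelSpace (wedgeKernel H)))
instance : InnerProductSpace ℂ (Fock H) :=
  inferInstanceAs (InnerProductSpace ℂ (KernelSpace (wedgeKernel H)))
instance : CompleteSpace (Fock H) :=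
  inferInstanceAs (CompleteSpace (KernelSpace (wedgeKernel H)))

/-- The vector `ξ₁ ∧ ⋯ ∧ ξ_k` of the Fock space. -/
def Fock.wedge (p : Wedge H) : Fock H := KernelSpace.point (wedgeKernel H) p

theorem Fock.inner_wedge (p q : Wedge H) :
    inner ℂ (Fock.wedge p) (Fock.wedge q) = (wedgeInner p q : ℂ) :=
  KernelSpace.inner_point (wedgeKernel H) p q

theorem Fock.hom_ext {V : Type*} [NormedAddCommGroup V] [NormedSpace ℂ V] {f g : Fock H →L[ℂ] V}
    (h : ∀ p, f (Fock.wedge p) = g (Fock.wedge p)) : f = g :=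
  KernelSpace.hom_ext (wedgeKernel H) h

/-- `η ∧ ξ₁ ∧ ⋯ ∧ ξ_k`. -/
def Wedge.cons (η : H) (p : Wedge H) : Wedge H := ⟨p.deg + 1, Fin.cons η p.vec⟩

/-- The creation operator `ξ₁ ∧ ⋯ ∧ ξ_k ↦ η ∧ ξ₁ ∧ ⋯ ∧ ξ_k` on formal linear combinations. -/
def preCreation (η : H) : PreKernelSpace (wedgeKernel H) →ₗ[ℂ] PreKernelSpace (wedgeKernel H) :=
  PreKernelSpace.lift _ fun p => PreKernelSpace.single _ (p.cons η)

/-- The contraction `ξ₁ ∧ ⋯ ∧ ξ_k ↦ ∑ (-1)ⁱ⁻¹ ⟨η, ξᵢ⟩ ξ₁ ∧ ⋯ ξ̂ᵢ ⋯ ∧ ξ_k` of a decomposable wedge. -/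
def contractWedge (η : H) : Wedge H → PreKernelSpace (wedgeKernel H)
  | ⟨0, _⟩ => 0
  | ⟨k + 1, v⟩ => ∑ i : Fin (k + 1), (((-1) ^ (i : ℕ) * ⟪η, v i⟫_ℝ : ℝ) : ℂ) •
      PreKernelSpace.single (wedgeKernel H) ⟨k, fun j => v (i.succAbove j)⟩

/-- The annihilation operator on formal linear combinations. -/
def preAnnihilation (η : H) :
    PreKernelSpace (wedgeKernel H) →ₗ[ℂ] PreKernelSpace (wedgeKernel H) :=
  PreKernelSpace.lift _ (contractWedge η)

theorem preCreation_adjoint (η : H) (c d : PreKernelSpace (wedgeKernel H)) :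
    inner ℂ (preCreation η c) d = inner ℂ c (preAnnihilation η d) := by
  refine PreKernelSpace.inner_eq _ _ (preCreation η) LinearMap.id LinearMap.id
    (preAnnihilation η) ?_ c d
  rintro ⟨k, v⟩ ⟨l, w⟩
  simp only [preCreation, preAnnihilation, PreKernelSpace.lift_single, LinearMap.id_apply]
  rw [PreKernelSpace.inner_single]
  cases l with
  | zero =>
    simp only [contractWedge, inner_zero_right]
    change ((wedgeInner _ _ : ℝ) : ℂ) = 0
    rw [Wedge.cons, wedgeInner_mk_ne (by simp), Complex.ofReal_zero]
  | succ l =>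
    simp only [contractWedge, inner_sum, inner_smul_right, PreKernelSpace.inner_single]
    change ((wedgeInner _ _ : ℝ) : ℂ) = ∑ i, _ * ((wedgeInner _ _ : ℝ) : ℂ)
    by_cases h : k = l
    · subst h
      rw [Wedge.cons, wedgeInner_mk, Matrix.det_succ_row_zero]
      push_cast
      refine Finset.sum_congr rfl fun i _ => ?_
      rw [wedgeInner_mk]
      simp only [Matrix.of_apply, Fin.cons_zero]
      rfl
    · rw [Wedge.cons, wedgeInner_mk_ne (by simpa using h), Complex.ofReal_zero]
      simp [wedgeInner_mk_ne h]

theorem preCreation_car (η : H) (c : PreKernelSpace (wedgeKernel H)) :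
    preAnnihilation η (preCreation η c) + preCreation η (preAnnihilation η c)
      = ((‖η‖ ^ 2 : ℝ) : ℂ) • c := by
  have : preAnnihilation η ∘ₗ preCreation η + preCreation η ∘ₗ preAnnihilation η
      = ((‖η‖ ^ 2 : ℝ) : ℂ) • LinearMap.id := by
    refine PreKernelSpace.hom_ext _ ?_
    rintro ⟨k, v⟩
    simp only [LinearMap.add_apply, LinearMap.comp_apply, LinearMap.smul_apply, LinearMap.id_apply,
      preCreation, preAnnihilation, PreKernelSpace.lift_single, Wedge.cons]
    simp only [contractWedge]
    rw [Fin.sum_univ_succ]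
    cases k with
    | zero =>
      simp
    | succ k =>
      simp only [map_sum, map_smul, PreKernelSpace.lift_single]
      rw [add_assoc, ← Finset.sum_add_distrib, Finset.sum_eq_zero, add_zero]
      · simp
      · intro i _
        have h : (fun j => (Fin.cons η v : Fin (k + 1 + 1) → H) (i.succ.succAbove j))
            = Fin.cons η fun j => v (i.succAbove j) := by
          funext j
          refine Fin.cases ?_ (fun j => ?_) j
          · simp
          · simp
        rw [h, ← add_smul]
        simp [pow_succ]
  simpa using congrArg (fun l => l c) this

theorem norm_preCreation_le (η : H) (c : PreKernelSpace (wedgeKernel H)) :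
    ‖preCreation η c‖ ≤ ‖η‖ * ‖c‖ := by
  have h1 : inner ℂ (preCreation η c) (preCreation η c)
      = inner ℂ c (preAnnihilation η (preCreation η c)) := preCreation_adjoint η c _
  have h2 : inner ℂ (preAnnihilation η c) (preAnnihilation η c)
      = inner ℂ c (preCreation η (preAnnihilation η c)) := by
    have := congrArg conj (preCreation_adjoint η (preAnnihilation η c) c)
    simpa [inner_conj_symm] using this.symm
  have h3 := congrArg (fun d => RCLike.re (inner ℂ c d)) (preCreation_car η c)
  simp only [inner_add_right, ← h1, ← h2, inner_smul_right, map_add,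
    inner_self_eq_norm_sq (𝕜 := ℂ)] at h3
  have h4 : RCLike.re (((‖η‖ ^ 2 : ℝ) : ℂ) * inner ℂ c c) = ‖η‖ ^ 2 * ‖c‖ ^ 2 := by
    rw [← inner_self_eq_norm_sq (𝕜 := ℂ) c]
    exact Complex.re_ofReal_mul _ _
  rw [h4] at h3
  refine abs_le_of_sq_le_sq' ?_ (by positivity) |>.2
  nlinarith [sq_nonneg ‖preAnnihilation η c‖]

/-- The creation operator `η ∧ ·` on the Fock space. -/
def creation (η : H) : Fock H →L[ℂ] Fock H :=
  KernelSpace.extend _ _ (preCreation η) ‖η‖ (norm_preCreation_le η)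

theorem creation_wedge (η : H) (p : Wedge H) :
    creation η (Fock.wedge p) = Fock.wedge (p.cons η) :=
  (KernelSpace.extend_mk _ _ (preCreation η) ‖η‖ (norm_preCreation_le η) _).trans
    (congrArg (KernelSpace.mk _) (PreKernelSpace.lift_single _ _ p))

/-- The Clifford operator `η̂ = c(η) + c(η)*` on the Fock space. -/
def cliffordOperator (η : H) : Fock H →L[ℂ] Fock H :=
  creation η + ContinuousLinearMap.adjoint (creation η)

variable (H) in
/-- The complex Clifford algebra of the real Hilbert space `H`, as the unital C*-algebra of
operators on the Fock space generated by the Clifford operators. -/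
def cliffordSubalgebra : StarSubalgebra ℂ (Fock H →L[ℂ] Fock H) :=
  (StarAlgebra.adjoin ℂ (Set.range (cliffordOperator (H := H)))).topologicalClosure

variable (H) in
/-- The complex Clifford C*-algebra of a real Hilbert space. -/
def Cliff : Type _ := cliffordSubalgebra H

instance : CStarAlgebra (Cliff H) :=
  haveI : IsClosed (cliffordSubalgebra H : Set (Fock H →L[ℂ] Fock H)) :=
    StarSubalgebra.isClosed_topologicalClosure _
  inferInstanceAs (CStarAlgebra (cliffordSubalgebra H))

/-- A vector of `H`, viewed as a (self-adjoint) element of the Clifford algebra. -/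
def Cliff.ι (η : H) : Cliff H :=
  ⟨cliffordOperator η, StarSubalgebra.le_topologicalClosure _ (StarAlgebra.subset_adjoin ℂ _ ⟨η, rfl⟩)⟩

theorem Cliff.isSelfAdjoint_ι (η : H) : IsSelfAdjoint (Cliff.ι η) := by
  refine Subtype.ext ?_
  change star (creation η + star (creation η)) = creation η + star (creation η)
  rw [star_add, star_star, add_comm]

/-- Entrywise application of a linear isometric isomorphism. -/
def Wedge.map (U : H ≃ₗᵢ[ℝ] H') : Wedge H ≃ Wedge H' where
  toFun p := ⟨p.deg, fun i => U (p.vec i)⟩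
  invFun p := ⟨p.deg, fun i => U.symm (p.vec i)⟩
  left_inv p := by simp
  right_inv p := by simp

/-- Second quantization: the unitary `ξ₁ ∧ ⋯ ∧ ξ_k ↦ U ξ₁ ∧ ⋯ ∧ U ξ_k` of Fock spaces. -/
def fockMap (U : H ≃ₗᵢ[ℝ] H') : Fock H ≃ₗᵢ[ℂ] Fock H' :=
  KernelSpace.map _ _ (Wedge.map U) fun p q => by
    change ((wedgeInner _ _ : ℝ) : ℂ) = ((wedgeInner _ _ : ℝ) : ℂ)
    simp only [wedgeInner, Wedge.map, Equiv.coe_fn_mk, U.inner_map_map]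
    rfl

theorem fockMap_wedge (U : H ≃ₗᵢ[ℝ] H') (p : Wedge H) :
    fockMap U (Fock.wedge p) = Fock.wedge (Wedge.map U p) :=
  KernelSpace.map_point _ _ _ _ p

theorem fockMap_creation (U : H ≃ₗᵢ[ℝ] H') (η : H) :
    (fockMap U).conjStarAlgEquiv (creation η) = creation (U η) := by
  refine Fock.hom_ext fun p => ?_
  rw [LinearIsometryEquiv.conjStarAlgEquiv_apply_apply]
  have h : (fockMap U).symm (Fock.wedge p) = Fock.wedge ((Wedge.map U).symm p) := by
    rw [LinearIsometryEquiv.symm_apply_eq, fockMap_wedge, Equiv.apply_symm_apply]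
  rw [h, creation_wedge, fockMap_wedge, creation_wedge]
  congr 1
  obtain ⟨k, v⟩ := p
  refine Wedge.ext rfl (heq_of_eq ?_)
  funext i
  refine Fin.cases ?_ (fun j => ?_) i
  · rfl
  · exact U.apply_symm_apply (v j)

section Conj

variable {E E' : Type*} [NormedAddCommGroup E] [InnerProductSpace ℂ E] [CompleteSpace E]
  [NormedAddCommGroup E'] [InnerProductSpace ℂ E'] [CompleteSpace E'] (e : E ≃ₗᵢ[ℂ] E')

theorem conj_add_star (a : E →L[ℂ] E) :
    e.conjStarAlgEquiv (a + star a) = e.conjStarAlgEquiv a + star (e.conjStarAlgEquiv a) := by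
  rw [map_add, map_star]

/-- Conjugation by a unitary maps the closed star subalgebra generated by a set into the one generated
by the image. -/
theorem conj_mem_closure {S : Set (E →L[ℂ] E)} {S' : Set (E' →L[ℂ] E')}
    (h : ∀ a ∈ S, e.conjStarAlgEquiv a ∈ S') {a : E →L[ℂ] E}
    (ha : a ∈ (StarAlgebra.adjoin ℂ S).topologicalClosure) :
    e.conjStarAlgEquiv a ∈ (StarAlgebra.adjoin ℂ S').topologicalClosure := by
  have hc : Continuous e.conjStarAlgEquiv :=
    (StarAlgEquiv.isometry e.conjStarAlgEquiv).continuous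
  have hle : StarAlgebra.adjoin ℂ S
      ≤ (StarAlgebra.adjoin ℂ S').comap (StarAlgEquiv.toStarAlgHom e.conjStarAlgEquiv) :=
    StarAlgebra.adjoin_le fun a ha => StarAlgebra.subset_adjoin ℂ _ (h a ha)
  exact map_mem_closure hc ha fun x hx => hle hx

theorem conj_symm_mem_closure {S : Set (E →L[ℂ] E)} {S' : Set (E' →L[ℂ] E')}
    (h : ∀ a ∈ S', ∃ b ∈ S, e.conjStarAlgEquiv b = a) {a : E' →L[ℂ] E'}
    (ha : a ∈ (StarAlgebra.adjoin ℂ S').topologicalClosure) :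
    e.conjStarAlgEquiv.symm a ∈ (StarAlgebra.adjoin ℂ S).topologicalClosure := by
  rw [LinearIsometryEquiv.symm_conjStarAlgEquiv]
  refine conj_mem_closure e.symm (fun a ha => ?_) ha
  obtain ⟨b, hb, rfl⟩ := h a ha
  rw [← LinearIsometryEquiv.symm_conjStarAlgEquiv]
  exact ((e.conjStarAlgEquiv.symm_apply_apply b).symm ▸ hb :)

/-- Conjugation by a unitary, as a *-isomorphism between the C*-algebras of operators generated by two
sets of operators that correspond to each other. -/
def conjClosure {S : Set (E →L[ℂ] E)} {S' : Set (E' →L[ℂ] E')}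
    (h : ∀ a ∈ S, e.conjStarAlgEquiv a ∈ S') (h' : ∀ a ∈ S', ∃ b ∈ S, e.conjStarAlgEquiv b = a) :
    (StarAlgebra.adjoin ℂ S).topologicalClosure ≃⋆ₐ[ℂ]
      (StarAlgebra.adjoin ℂ S').topologicalClosure where
  toFun a := ⟨e.conjStarAlgEquiv a, conj_mem_closure e h a.2⟩
  invFun a := ⟨e.conjStarAlgEquiv.symm a, conj_symm_mem_closure e h' a.2⟩
  left_inv _ := Subtype.ext (StarAlgEquiv.symm_apply_apply _ _)
  right_inv _ := Subtype.ext (StarAlgEquiv.apply_symm_apply _ _)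
  map_mul' _ _ := Subtype.ext (map_mul e.conjStarAlgEquiv _ _)
  map_add' _ _ := Subtype.ext (map_add e.conjStarAlgEquiv _ _)
  map_star' _ := Subtype.ext (map_star e.conjStarAlgEquiv _)
  map_smul' r _ := Subtype.ext (map_smul e.conjStarAlgEquiv r _)

end Conj

theorem fockMap_cliffordOperator (U : H ≃ₗᵢ[ℝ] H') (η : H) :
    (fockMap U).conjStarAlgEquiv (cliffordOperator η) = cliffordOperator (U η) :=
  (conj_add_star (fockMap U) (creation η)).trans
    (congrArg (fun a => a + star a) (fockMap_creation U η))

/-- Functoriality of the Clifford algebra: the *-isomorphism sending `η̂` to `(U η)^`. -/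
def Cliff.map (U : H ≃ₗᵢ[ℝ] H') : Cliff H ≃⋆ₐ[ℂ] Cliff H' :=
  conjClosure (fockMap U)
    (by rintro _ ⟨η, rfl⟩; exact ⟨U η, (fockMap_cliffordOperator U η).symm⟩)
    (by
      rintro _ ⟨η, rfl⟩
      refine ⟨_, ⟨U.symm η, rfl⟩, ?_⟩
      rw [fockMap_cliffordOperator, U.apply_symm_apply])

theorem Cliff.map_ι (U : H ≃ₗᵢ[ℝ] H') (η : H) : Cliff.map U (Cliff.ι η) = Cliff.ι (U η) :=
  Subtype.ext (fockMap_cliffordOperator U η)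

end Fock

/-! ## Hilbert–Hadamard spaces -/

section Metric

universe u

variable {M : Type u} [MetricSpace M]

/-- `c : [0,1] → M` is an affinely parametrized geodesic segment from `x` to `y`. -/
def IsGeodesic (x y : M) (c : unitInterval → M) : Prop :=
  c 0 = x ∧ c 1 = y ∧ ∀ s t : unitInterval, dist (c s) (c t) = |(s : ℝ) - t| * dist x y

/-- Any two points are connected by a geodesic segment. -/
def IsGeodesicSpace (M : Type*) [MetricSpace M] : Prop :=
  ∀ x y : M, ∃ c, IsGeodesic x y c

/-- The CAT(0) condition: geodesic triangles are no thicker than their Euclidean comparison triangles.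
It suffices to compare points on two sides `[p,q]`, `[p,r]` with a common vertex `p`, where `p` is an
arbitrary vertex of the triangle. -/
def IsCAT0 (M : Type*) [MetricSpace M] : Prop :=
  IsGeodesicSpace M ∧
  ∀ (p q r : M) (c₁ c₂ : unitInterval → M), IsGeodesic p q c₁ → IsGeodesic p r c₂ →
    ∀ p' q' r' : EuclideanSpace ℝ (Fin 2),
      dist p' q' = dist p q → dist p' r' = dist p r → dist q' r' = dist q r →
      ∀ s t : unitInterval, dist (c₁ s) (c₂ t)
        ≤ dist (AffineMap.lineMap p' q' (s : ℝ)) (AffineMap.lineMap p' r' (t : ℝ))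

/-- The comparison angle at `y` of a triple of points `x, y, z`. -/
def comparisonAngle (x y z : M) : ℝ :=
  Real.arccos ((dist x y ^ 2 + dist y z ^ 2 - dist x z ^ 2) / (2 * dist x y * dist y z))

/-- Nontrivial geodesic segments emanating from `p`. -/
structure GeodesicFrom (p : M) where
  /-- the path -/
  path : unitInterval → M
  isGeodesic : IsGeodesic p (path 1) path
  nontrivial : path 1 ≠ p

/-- The angle between two geodesic segments emanating from `p`: the limit of the comparison angles
(which exists in every CAT(0) space). -/
def angle {p : M} (α β : GeodesicFrom p) : ℝ :=
  limUnder (𝓝[>] (0 : unitInterval) ×ˢ 𝓝[>] (0 : unitInterval))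
    fun st => comparisonAngle (α.path st.1) p (β.path st.2)

/-- Points of the tangent cone at `p`: the tip, and the pairs `(α, t)` of a direction, represented by a
geodesic segment `α` emanating from `p`, and a radius `t ≥ 0`. These are representatives of points:
those at distance zero, such as `(α, t)` and `(β, t)` with `α, β` at angle zero, or `(α, 0)` and the
tip, are the same point of the tangent cone. -/
inductive TangentCone (p : M) : Type _
  | tip : TangentCone p
  | ray (α : GeodesicFrom p) (t : ℝ≥0) : TangentCone p

/-- The distance of the tangent cone: that of the Euclidean cone over the space of directions with the
angle as its distance. -/
def TangentCone.coneDist {p : M} : TangentCone p → TangentCone p → ℝ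
  | tip, tip => 0
  | tip, ray _ t => t
  | ray _ t, tip => t
  | ray α t, ray β s => √((t : ℝ) ^ 2 + (s : ℝ) ^ 2 - 2 * t * s * Real.cos (angle α β))

/-- A Hilbert–Hadamard space: a complete (geodesic) CAT(0) space all of whose tangent cones embed
isometrically into Hilbert spaces. (A cone embeds if and only if its completion does.) -/
class _root_.HilbertHadamardSpace (M : Type u) [MetricSpace M] : Prop where
  complete : CompleteSpace M
  cat0 : IsCAT0 M
  embeds : ∀ p : M, ∃ (E : Type u) (_ : NormedAddCommGroup E) (_ : InnerProductSpace ℝ E)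
    (_ : CompleteSpace E) (f : TangentCone p → E), ∀ v w, dist (f v) (f w) = v.coneDist w

/-- Distance-preserving representatives of the tangent cone span a Hilbert space: Schoenberg's kernel
`½ (d(v,o)² + d(w,o)² - d(v,w)²)` of the tangent cone, where `o` is the tip. -/
def coneKernel (p : M) [HilbertHadamardSpace M] : PSDKernel ℝ (TangentCone p) where
  val v w := (v.coneDist .tip ^ 2 + w.coneDist .tip ^ 2 - v.coneDist w ^ 2) / 2
  conj_symm v w := by
    obtain ⟨E, _, _, _, f, hf⟩ := HilbertHadamardSpace.embeds p
    simp only [← hf, conj_trivial, dist_comm (f w) (f v)]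
    ring
  nonneg c := by
    obtain ⟨E, _, _, _, f, hf⟩ := HilbertHadamardSpace.embeds p
    have key : ∀ v w : TangentCone p,
        (v.coneDist .tip ^ 2 + w.coneDist .tip ^ 2 - v.coneDist w ^ 2) / 2
          = ⟪f v - f .tip, f w - f .tip⟫_ℝ := by
      intro v w
      rw [← hf, ← hf, ← hf, real_inner_eq_norm_mul_self_add_norm_mul_self_sub_norm_sub_mul_self_div_two,
        sub_sub_sub_cancel_right, dist_eq_norm, dist_eq_norm, dist_eq_norm]
      ring
    have : RCLike.re (c.sum fun v a => c.sum fun w b => conj a * b *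
          ((v.coneDist .tip ^ 2 + w.coneDist .tip ^ 2 - v.coneDist w ^ 2) / 2))
        = ⟪c.sum fun v a => a • (f v - f .tip), c.sum fun v a => a • (f v - f .tip)⟫_ℝ := by
      simp only [key, Finsupp.sum, sum_inner, inner_sum, real_inner_smul_left,
        real_inner_smul_right, conj_trivial, RCLike.re_to_real]
      rw [Finset.sum_comm]
      refine Finset.sum_congr rfl fun v _ => Finset.sum_congr rfl fun w _ => ?_
      rw [real_inner_comm]
      ring
    rw [this]
    exact real_inner_self_nonneg

theorem coneKernel_val {p : M} [HilbertHadamardSpace M] (v w : TangentCone p) :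
    (coneKernel p).val v w
      = (v.coneDist .tip ^ 2 + w.coneDist .tip ^ 2 - v.coneDist w ^ 2) / 2 := rfl

/-- The tangent Hilbert space `H_p M`: the Hilbert space spanned by the tangent cone at `p`, with the tip
as its origin. (The point `v` of the cone corresponds to the formal difference `v - tip`, and the inner
product is `⟨∑ aᵥ v, ∑ b_w w⟩ = -½ ∑ aᵥ b_w d(v,w)²` on combinations with coefficient sum zero.) -/
def TangentHilbert (p : M) [HilbertHadamardSpace M] : Type u := KernelSpace (coneKernel p)

instance (p : M) [HilbertHadamardSpace M] : NormedAddCommGroup (TangentHilbert p) :=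
  inferInstanceAs (NormedAddCommGroup (KernelSpace (coneKernel p)))
instance (p : M) [HilbertHadamardSpace M] : InnerProductSpace ℝ (TangentHilbert p) :=
  inferInstanceAs (InnerProductSpace ℝ (KernelSpace (coneKernel p)))
instance (p : M) [HilbertHadamardSpace M] : CompleteSpace (TangentHilbert p) :=
  inferInstanceAs (CompleteSpace (KernelSpace (coneKernel p)))

/-- The canonical isometric embedding of the tangent cone into the tangent Hilbert space. -/
def TangentCone.toHilbert {p : M} [HilbertHadamardSpace M] (v : TangentCone p) :
    TangentHilbert p :=
  KernelSpace.point (coneKernel p) v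

theorem TangentCone.inner_toHilbert {p : M} [HilbertHadamardSpace M] (v w : TangentCone p) :
    ⟪v.toHilbert, w.toHilbert⟫_ℝ
      = (v.coneDist .tip ^ 2 + w.coneDist .tip ^ 2 - v.coneDist w ^ 2) / 2 :=
  KernelSpace.inner_point (coneKernel p) v w

theorem TangentCone.toHilbert_tip (p : M) [HilbertHadamardSpace M] :
    (TangentCone.tip : TangentCone p).toHilbert = 0 := by
  rw [← inner_self_eq_zero (𝕜 := ℝ), inner_toHilbert]
  simp [coneDist]

theorem TangentCone.dist_toHilbert {p : M} [HilbertHadamardSpace M] (v w : TangentCone p) :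
    dist v.toHilbert w.toHilbert = v.coneDist w := by
  obtain ⟨E, _, _, _, f, hf⟩ := HilbertHadamardSpace.embeds p
  have h : ∀ v : TangentCone p, v.coneDist v = 0 := fun v => by rw [← hf, dist_self]
  have h0 : 0 ≤ v.coneDist w := by rw [← hf]; exact dist_nonneg
  have hs : w.coneDist v = v.coneDist w := by rw [← hf, ← hf, dist_comm]
  rw [dist_eq_norm, ← Real.sqrt_sq (norm_nonneg _), ← Real.sqrt_sq h0,
    ← real_inner_self_eq_norm_sq, inner_sub_left, inner_sub_right, inner_sub_right]
  simp only [inner_toHilbert]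
  congr 1
  simp only [h, hs]
  ring

/-- A choice of geodesic segment `[x, y]` (it is unique in a CAT(0) space). -/
def geodesic [h : HilbertHadamardSpace M] (x y : M) : unitInterval → M :=
  (h.cat0.1 x y).choose

theorem isGeodesic_geodesic [h : HilbertHadamardSpace M] (x y : M) :
    IsGeodesic x y (geodesic x y) :=
  (h.cat0.1 x y).choose_spec

/-- The nontrivial geodesic segment from `x` to a different point `y`. -/
def GeodesicFrom.of [HilbertHadamardSpace M] {x y : M} (h : y ≠ x) : GeodesicFrom x where
  path := geodesic x y
  isGeodesic := by
    have hg := isGeodesic_geodesic x y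
    rwa [hg.2.1]
  nontrivial := by rwa [(isGeodesic_geodesic x y).2.1]

open Classical in
/-- The logarithm `log_x(y) = [([x, y], d(x, y))]`, a point of the tangent cone at `x`. -/
def log [HilbertHadamardSpace M] (x y : M) : TangentCone x :=
  if h : y = x then .tip else .ray (.of h) (nndist x y)

/-- The image `φ ∘ α` of a geodesic segment under an isometry. -/
def GeodesicFrom.map (φ : M ≃ᵢ M) {p q : M} (h : φ p = q) (α : GeodesicFrom p) :
    GeodesicFrom q where
  path t := φ (α.path t)
  isGeodesic := by
    obtain ⟨h0, -, h2⟩ := α.isGeodesic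
    exact ⟨(congrArg φ h0).trans h, rfl, fun s t => by rw [φ.dist_eq, h2, ← h, φ.dist_eq]⟩
  nontrivial := fun h' => α.nontrivial (φ.injective (h'.trans h.symm))

theorem angle_map (φ : M ≃ᵢ M) {p q : M} (h : φ p = q) (α β : GeodesicFrom p) :
    angle (α.map φ h) (β.map φ h) = angle α β := by
  subst h
  simp only [angle, comparisonAngle, GeodesicFrom.map, φ.dist_eq]

/-- The derivative `D_p φ : T_p M → T_q M`, `q = φ p`, of an isometry `φ` of `M`, given by
`[(α, t)] ↦ [(φ ∘ α, t)]`. -/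
def coneMap (φ : M ≃ᵢ M) {p q : M} (h : φ p = q) : TangentCone p ≃ TangentCone q where
  toFun
    | .tip => .tip
    | .ray α t => .ray (α.map φ h) t
  invFun
    | .tip => .tip
    | .ray α t => .ray (α.map φ.symm (by rw [← h, φ.symm_apply_apply])) t
  left_inv v := by
    cases v with
    | tip => rfl
    | ray α t =>
      simp only [TangentCone.ray.injEq, and_true]
      cases α
      simp [GeodesicFrom.map]
  right_inv v := by
    cases v with
    | tip => rfl
    | ray α t =>
      simp only [TangentCone.ray.injEq, and_true]
      cases α
      simp [GeodesicFrom.map]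

theorem coneMap_tip (φ : M ≃ᵢ M) {p q : M} (h : φ p = q) :
    coneMap φ h .tip = .tip := rfl

theorem coneDist_map (φ : M ≃ᵢ M) {p q : M} (h : φ p = q) (v w : TangentCone p) :
    (coneMap φ h v).coneDist (coneMap φ h w) = v.coneDist w := by
  cases v <;> cases w <;> simp [coneMap, TangentCone.coneDist, angle_map]

/-- The isometric isomorphism of tangent Hilbert spaces induced by the derivative of an isometry. -/
def hilbertMap [HilbertHadamardSpace M] (φ : M ≃ᵢ M) {p q : M} (h : φ p = q) :
    TangentHilbert p ≃ₗᵢ[ℝ] TangentHilbert q :=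
  KernelSpace.map (coneKernel p) (coneKernel q) (coneMap φ h) fun v w => by
    rw [coneKernel_val, coneKernel_val, ← coneMap_tip φ h, coneDist_map, coneDist_map, coneDist_map]

theorem hilbertMap_toHilbert [HilbertHadamardSpace M] (φ : M ≃ᵢ M) {p q : M} (h : φ p = q)
    (v : TangentCone p) : hilbertMap φ h v.toHilbert = (coneMap φ h v).toHilbert :=
  KernelSpace.map_point (coneKernel p) (coneKernel q) (coneMap φ h) _ v

end Metric

/-! ## The C*-algebras attached to a Hilbert–Hadamard space -/

section Algebra

universe u

variable {M : Type u} [MetricSpace M] [HilbertHadamardSpace M]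

/-- `H_x M ⊕ tℝ`, where `tℝ = ℝ` if `t > 0` and `tℝ = 0` if `t = 0`. -/
abbrev TangentSum (x : M) (t : ℝ≥0) : Type u :=
  WithLp 2 (TangentHilbert x × Submodule.span ℝ {(t : ℝ)})

/-- The vector `(v, t)` of `H_x M ⊕ tℝ`. -/
def TangentSum.mk {x : M} (v : TangentHilbert x) (t : ℝ≥0) : TangentSum x t :=
  WithLp.toLp 2 (v, ⟨(t : ℝ), Submodule.mem_span_singleton_self _⟩)

/-- `H(D_p φ) ⊕ id : H_p M ⊕ tℝ → H_q M ⊕ tℝ` for an isometry `φ` with `φ p = q`. -/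
def tangentSumMap (φ : M ≃ᵢ M) {p q : M} (h : φ p = q) (t : ℝ≥0) :
    TangentSum p t ≃ₗᵢ[ℝ] TangentSum q t where
  toLinearEquiv := (WithLp.linearEquiv 2 ℝ _).trans
    (((hilbertMap φ h).toLinearEquiv.prodCongr (LinearEquiv.refl ℝ _)).trans
      (WithLp.linearEquiv 2 ℝ _).symm)
  norm_map' v := by
    simp [WithLp.prod_norm_eq_of_L2]

variable (M) in
/-- The product `Π(M)` of the Clifford algebras of `H_x M ⊕ tℝ` over all `(x, t) ∈ M × [0, ∞)`. -/
abbrev PiAlg : Type u := ∀ z : M × ℝ≥0, Cliff (TangentSum z.1 z.2)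

variable (M) in
/-- The C*-algebra `Π_b(M)` of bounded elements of `Π(M)`, with the supremum norm. -/
abbrev PiB : Type u := lp (fun z : M × ℝ≥0 => Cliff (TangentSum z.1 z.2)) ∞

/-- The Clifford operator `C_{x₀} ∈ Π(M)`, `C_{x₀}(x, t) = (-log_x(x₀), t)`. -/
def cliffordMultiplier (x₀ : M) : PiAlg M :=
  fun z => Cliff.ι (TangentSum.mk (-(log z.1 x₀).toHilbert) z.2)

/-- `f(C_{x₀}(x, t))`, by continuous functional calculus in the Clifford algebra of `H_x M ⊕ tℝ`. (The
function `f` on `ℝ` is extended to `ℂ` as `f ∘ re`; the spectrum of a self-adjoint element is real.) -/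
def bottField (x₀ : M) (f : C₀(ℝ, ℂ)) : PiAlg M :=
  fun z => cfc (fun w : ℂ => f w.re) (cliffordMultiplier x₀ z)

theorem memℓp_bottField (x₀ : M) (f : C₀(ℝ, ℂ)) : Memℓp (bottField x₀ f) ∞ := by
  refine memℓp_infty ⟨‖f.toBCF‖, ?_⟩
  rintro _ ⟨z, rfl⟩
  exact norm_cfc_le (norm_nonneg _) fun w _ => f.toBCF.norm_coe_le_norm w.re

theorem isStarNormal_cliffordMultiplier (x₀ : M) (z : M × ℝ≥0) :
    IsStarNormal (cliffordMultiplier x₀ z) :=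
  (Cliff.isSelfAdjoint_ι _).isStarNormal

/-- The Bott homomorphism `β_{x₀} : C₀(ℝ) → Π_b(M)`, `β_{x₀}(f)(x, t) = f(C_{x₀}(x, t))`. -/
def bott (x₀ : M) : C₀(ℝ, ℂ) →⋆ₙₐ[ℂ] PiB M where
  toFun f := ⟨bottField x₀ f, memℓp_bottField x₀ f⟩
  map_smul' r f := by
    ext z
    have := isStarNormal_cliffordMultiplier x₀ z
    exact cfc_const_mul r (fun w : ℂ => f w.re) (cliffordMultiplier x₀ z) (by fun_prop)
  map_zero' := by
    ext z
    exact cfc_zero ℂ (cliffordMultiplier x₀ z)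
  map_add' f g := by
    ext z
    exact cfc_add (cliffordMultiplier x₀ z) (fun w : ℂ => f w.re) (fun w : ℂ => g w.re)
      (by fun_prop) (by fun_prop)
  map_mul' f g := by
    ext z
    exact cfc_mul (fun w : ℂ => f w.re) (fun w : ℂ => g w.re) (cliffordMultiplier x₀ z)
      (by fun_prop) (by fun_prop)
  map_star' f := by
    ext z
    exact cfc_star (fun w : ℂ => f w.re) (cliffordMultiplier x₀ z)

variable (M) in
/-- The C*-algebra `A(M)`: the C*-subalgebra of `Π_b(M)` generated by the ranges of all Bott
homomorphisms. -/
def algA : NonUnitalStarSubalgebra ℂ (PiB M) :=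
  (NonUnitalStarAlgebra.adjoin ℂ {a : PiB M | ∃ x₀ f, bott x₀ f = a}).topologicalClosure

variable (M) in
/-- The C*-algebra `A_ev(M)`: the C*-subalgebra generated by all `β_{x₀}(f)` with `f` even. -/
def algAev : NonUnitalStarSubalgebra ℂ (PiB M) :=
  (NonUnitalStarAlgebra.adjoin ℂ
    {a : PiB M | ∃ (x₀ : M) (f : C₀(ℝ, ℂ)), (∀ s, f (-s) = f s) ∧ bott x₀ f = a}).topologicalClosure

theorem algAev_le_algA : algAev M ≤ algA M :=
  NonUnitalStarSubalgebra.topologicalClosure_mono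
    (NonUnitalStarAlgebra.adjoin_mono fun _ ⟨x₀, f, _, h⟩ => ⟨x₀, f, h⟩)

instance isClosed_algA : IsClosed (algA M : Set (PiB M)) :=
  NonUnitalStarSubalgebra.isClosed_topologicalClosure _

instance isClosed_algAev : IsClosed (algAev M : Set (PiB M)) :=
  NonUnitalStarSubalgebra.isClosed_topologicalClosure _

variable (M) in
/-- The elements of `A(M)`. -/
def BottAlgebra : Type u := algA M

instance : NonUnitalCStarAlgebra (BottAlgebra M) :=
  inferInstanceAs (NonUnitalCStarAlgebra (algA M))

variable (M) in
/-- The elements of `A_ev(M)`. -/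
def EvenBottAlgebra : Type u := algAev M

instance : NonUnitalCStarAlgebra (EvenBottAlgebra M) :=
  inferInstanceAs (NonUnitalCStarAlgebra (algAev M))

/-- The inclusion `A(M) → Π_b(M)`. -/
def BottAlgebra.incl : BottAlgebra M →⋆ₙₐ[ℂ] PiB M := NonUnitalStarSubalgebraClass.subtype (algA M)

/-- The inclusion `A_ev(M) → Π_b(M)`. -/
def EvenBottAlgebra.incl : EvenBottAlgebra M →⋆ₙₐ[ℂ] PiB M :=
  NonUnitalStarSubalgebraClass.subtype (algAev M)

/-- The *-endomorphism `φ_*` of `Π_b(M)` induced by an isometry `φ` of `M`: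
`φ_*(σ)(x, t) = Cliff(H(D_{φ⁻¹(x)} φ) ⊕ id) (σ(φ⁻¹(x), t))`. -/
def pushforward (φ : M ≃ᵢ M) : PiB M →⋆ₙₐ[ℂ] PiB M where
  toFun σ := ⟨fun z => Cliff.map (tangentSumMap φ (φ.apply_symm_apply z.1) z.2)
      (σ (φ.symm z.1, z.2)), by
    refine memℓp_infty ⟨‖σ‖, ?_⟩
    rintro _ ⟨z, rfl⟩
    exact (StarAlgEquiv.norm_map (Cliff.map _) _).trans_le (lp.norm_apply_le_norm (by simp) σ _)⟩
  map_smul' r σ := by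
    ext z
    exact map_smul (Cliff.map _) r (σ (φ.symm z.1, z.2))
  map_zero' := by
    ext z
    exact map_zero (Cliff.map _)
  map_add' σ τ := by
    ext z
    exact map_add (Cliff.map _) (σ (φ.symm z.1, z.2)) (τ (φ.symm z.1, z.2))
  map_mul' σ τ := by
    ext z
    exact map_mul (Cliff.map _) (σ (φ.symm z.1, z.2)) (τ (φ.symm z.1, z.2))
  map_star' σ := by
    ext z
    exact map_star (Cliff.map _) (σ (φ.symm z.1, z.2))

end Algebra

/-! ## Proper actions on C*-algebras -/

section Proper

open WeakDual

variable {Γ : Type*} [Group Γ]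
variable {B C : Type*} [NonUnitalCStarAlgebra B] [NonUnitalCStarAlgebra C]

variable (B) in
/-- The spectrum `B̂` of a (commutative) C*-algebra: the space of its characters with the topology of
pointwise convergence. -/
abbrev Spectrum : Type _ := characterSpace ℂ B

/-- The pullback `χ ↦ χ ∘ e` of characters along a *-isomorphism of C*-algebras. -/
def charPullback (e : B ≃⋆ₐ[ℂ] C) (χ : Spectrum C) : Spectrum B :=
  ⟨StrongDual.toWeakDual
      { toFun := fun b => χ (e b)
        map_add' := fun a b => by rw [map_add, map_add]
        map_smul' := fun r a => by rw [map_smul, map_smul, RingHom.id_apply]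
        cont := (map_continuous χ).comp (StarAlgEquiv.isometry e).continuous }, by
    refine ⟨fun h => χ.2.1 (DFunLike.ext _ _ fun c => ?_), fun a b => ?_⟩
    · have := DFunLike.congr_fun h (e.symm c)
      change χ (e (e.symm c)) = 0 at this
      rwa [e.apply_symm_apply] at this
    · change χ (e (a * b)) = χ (e a) * χ (e b)
      rw [map_mul, map_mul]⟩

theorem charPullback_apply (e : B ≃⋆ₐ[ℂ] C) (χ : Spectrum C) (b : B) :
    charPullback e χ b = χ (e b) := rfl

theorem continuous_charPullback (e : B ≃⋆ₐ[ℂ] C) : Continuous (charPullback e) :=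
  Continuous.subtype_mk (WeakDual.continuous_of_continuous_eval fun b =>
    (WeakDual.eval_continuous (e b)).comp continuous_subtype_val) _

/-- The action by homeomorphisms on the spectrum induced by an action on a C*-algebra:
`(γ · χ)(b) = χ(γ⁻¹ · b)`. -/
def dualAction (ρ : Γ →* (B ≃⋆ₐ[ℂ] B)) : Γ →* (Spectrum B ≃ₜ Spectrum B) where
  toFun γ :=
    { toFun := charPullback (ρ γ⁻¹)
      invFun := charPullback (ρ γ)
      left_inv := fun χ => CharacterSpace.ext fun b => by
        rw [charPullback_apply, charPullback_apply, ← StarAlgEquiv.mul_apply, ← map_mul]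
        simp
      right_inv := fun χ => CharacterSpace.ext fun b => by
        rw [charPullback_apply, charPullback_apply, ← StarAlgEquiv.mul_apply, ← map_mul]
        simp
      continuous_toFun := continuous_charPullback _
      continuous_invFun := continuous_charPullback _ }
  map_one' := by
    refine Homeomorph.ext fun χ => CharacterSpace.ext fun b => ?_
    change χ (ρ 1⁻¹ b) = χ b
    rw [inv_one, map_one]
    rfl
  map_mul' γ δ := by
    refine Homeomorph.ext fun χ => CharacterSpace.ext fun b => ?_
    change χ (ρ (γ * δ)⁻¹ b) = χ (ρ δ⁻¹ (ρ γ⁻¹ b))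
    rw [mul_inv_rev, map_mul]
    rfl

variable (B) in
/-- The center `Z(B)` of a C*-algebra. -/
abbrev Center : NonUnitalStarSubalgebra ℂ B := NonUnitalStarSubalgebra.center ℂ B

instance isClosed_center : IsClosed (Center B : Set B) := by
  change IsClosed (Set.center B)
  rw [← Set.centralizer_univ]
  exact Set.isClosed_centralizer _

theorem map_mem_center (e : B ≃⋆ₐ[ℂ] B) {z : B} (hz : z ∈ Center B) : e z ∈ Center B := by
  rw [NonUnitalStarSubalgebra.mem_center_iff] at hz ⊢
  intro b
  have h := congrArg e (hz (e.symm b))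
  rwa [map_mul, map_mul, e.apply_symm_apply] at h

/-- The restriction of a *-automorphism to the center. -/
def centerMap (e : B ≃⋆ₐ[ℂ] B) : Center B ≃⋆ₐ[ℂ] Center B where
  toFun z := ⟨e z, map_mem_center e z.2⟩
  invFun z := ⟨e.symm z, map_mem_center e.symm z.2⟩
  left_inv _ := Subtype.ext (e.symm_apply_apply _)
  right_inv _ := Subtype.ext (e.apply_symm_apply _)
  map_mul' _ _ := Subtype.ext (map_mul e _ _)
  map_add' _ _ := Subtype.ext (map_add e _ _)
  map_star' _ := Subtype.ext (map_star e _)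
  map_smul' r _ := Subtype.ext (map_smul e r _)

/-- The restriction of an action on a C*-algebra to its center. -/
def centerAction (ρ : Γ →* (B ≃⋆ₐ[ℂ] B)) : Γ →* (Center B ≃⋆ₐ[ℂ] Center B) where
  toFun γ := centerMap (ρ γ)
  map_one' := by
    refine StarAlgEquiv.ext fun z => Subtype.ext ?_
    change ρ 1 (z : B) = z
    rw [map_one]
    rfl
  map_mul' γ δ := by
    refine StarAlgEquiv.ext fun z => Subtype.ext ?_
    change ρ (γ * δ) (z : B) = ρ γ (ρ δ z)
    rw [map_mul]
    rfl

/-- An action by homeomorphisms of a (discrete) group on a topological space is proper if every compact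
set meets only finitely many of its translates. -/
def IsProperAction {X : Type*} [TopologicalSpace X] (τ : Γ →* (X ≃ₜ X)) : Prop :=
  ∀ K : Set X, IsCompact K → {γ : Γ | (K ∩ τ γ '' K).Nonempty}.Finite

/-- `B`, with the action `ρ` of `Γ`, is a proper `Γ`-`X`-C*-algebra, where `X` is a locally compact
Hausdorff space with the action `τ` of `Γ`, through the structure map `π : Z(B)^ → X`. -/
structure IsProperCStarAlgebraOver {X : Type*} [TopologicalSpace X] (ρ : Γ →* (B ≃⋆ₐ[ℂ] B))
    (τ : Γ →* (X ≃ₜ X)) (π : Spectrum (Center B) → X) : Prop where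
  t2 : T2Space X
  locallyCompact : LocallyCompactSpace X
  continuous : Continuous π
  equivariant : ∀ γ χ, π (dualAction (centerAction ρ) γ χ) = τ γ (π χ)
  proper : IsProperAction τ

/-- An isometric action of `Γ` on a metric space is metrically proper if `d(x, γ x) → ∞` as `γ → ∞`. -/
def IsMetricallyProper {M : Type*} [MetricSpace M] (α : Γ →* (M ≃ᵢ M)) : Prop :=
  ∀ x : M, Tendsto (fun γ => dist x (α γ x)) cofinite atTop

end Proper
end HilbertHadamard
end

/-!
The key point is that `C_{x₀}(x, t)² = d(x, x₀)² + t²`: creation and annihilation operators satisfy the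
canonical anticommutation relations, so a vector `η` squares to `‖η‖²` in the Clifford algebra
(`Cliff.ι_mul_self`), and `log_x(x₀)` has norm `d(x, x₀)`. Hence an even function `f` of `C_{x₀}` is
the scalar field `f(√(d(x, x₀)² + t²))` (`bott_apply_of_even`), and `A_ev(M)` is central.

Geodesics in `M` are unique, so isometries preserve logarithms and `φ_*` sends `β_{x₀}(f)` to
`β_{φ(x₀)}(f)` (`pushforward_bott`). Therefore `φ_*` preserves both algebras, and the identities of an
action need to be checked on these generators only.

Everything else rests on the elements `Eₙ = β_{x₀}(fₙ)` of `A_ev(M)`, where `fₙ` is an even cutoff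
function equal to `1` on `[-n, n]` and supported in `[-n - 1, n + 1]`. They form an approximate unit for
`A(M)` (`tendsto_bott_cutoff_mul`), which gives the density of `A_ev(M) · A(M)` and the fact that a
character of the center of `A(M)` does not vanish on `A_ev(M)`. As `Eₙ` is a unit for `Eₘ` if `m < n`,
on a compact set of characters of `A_ev(M)` some `Eₙ` is constantly `1`. If `χ` and `γ · χ` are both in
this set, then `Eₙ` and its translate by `γ⁻¹` have a nonzero product, while their supports are disjoint
for all but finitely many `γ` as the action is metrically proper (`isProperAction_dualAction`,
`bott_cutoff_mul_eq_zero`).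
-/

noncomputable section

namespace HilbertHadamard

universe u

/-! ### The Clifford relation -/

section Clifford

variable {H : Type*} [NormedAddCommGroup H] [InnerProductSpace ℝ H]

/-- The canonical map from formal linear combinations of wedges to the Fock space. -/
def Fock.mk : PreKernelSpace (wedgeKernel H) →ₗᵢ[ℂ] Fock H := KernelSpace.mk (wedgeKernel H)

theorem Fock.denseRange_mk : DenseRange (Fock.mk (H := H)) :=
  KernelSpace.denseRange_mk (wedgeKernel H)

theorem creation_mk (η : H) (c : PreKernelSpace (wedgeKernel H)) :
    creation η (Fock.mk c) = Fock.mk (preCreation η c) :=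
  KernelSpace.extend_mk _ _ (preCreation η) ‖η‖ (norm_preCreation_le η) c

theorem adjoint_creation_mk (η : H) (c : PreKernelSpace (wedgeKernel H)) :
    ContinuousLinearMap.adjoint (creation η) (Fock.mk c) = Fock.mk (preAnnihilation η c) := by
  refine ext_inner_left ℂ fun v => ?_
  rw [ContinuousLinearMap.adjoint_inner_right]
  refine Fock.denseRange_mk.induction_on v (isClosed_eq (by fun_prop) (by fun_prop)) fun d => ?_
  rw [creation_mk, LinearIsometry.inner_map_map, LinearIsometry.inner_map_map,
    preCreation_adjoint]

/-- The canonical anticommutation relation `c(η)* c(η) + c(η) c(η)* = ‖η‖²`. -/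
theorem adjoint_creation_mul_add (η : H) :
    ContinuousLinearMap.adjoint (creation η) * creation η
        + creation η * ContinuousLinearMap.adjoint (creation η)
      = ((‖η‖ ^ 2 : ℝ) : ℂ) • (1 : Fock H →L[ℂ] Fock H) := by
  refine Fock.hom_ext fun p => ?_
  have h := congrArg Fock.mk (preCreation_car η (.single _ p))
  rw [map_add, map_smul, ← adjoint_creation_mk, ← creation_mk, ← creation_mk,
    ← adjoint_creation_mk] at h
  exact h

/-- `η ∧ η ∧ ξ = 0`, as the Gram determinant of a wedge with a repeated factor vanishes. -/
theorem creation_mul_self (η : H) : creation η * creation η = 0 := by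
  refine Fock.hom_ext fun p => ?_
  change creation η (creation η (Fock.wedge p)) = 0
  rw [creation_wedge, creation_wedge, ← inner_self_eq_zero (𝕜 := ℂ), Fock.inner_wedge,
    Wedge.cons, wedgeInner_mk]
  have h : (0 : Fin (p.deg + 1 + 1)) ≠ 1 := by simp
  exact_mod_cast Matrix.det_zero_of_row_eq h (by ext j; rfl)

theorem cliffordOperator_mul_self (η : H) :
    cliffordOperator η * cliffordOperator η
      = ((‖η‖ ^ 2 : ℝ) : ℂ) • (1 : Fock H →L[ℂ] Fock H) := by
  have h1 := creation_mul_self η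
  have h2 : ContinuousLinearMap.adjoint (creation η) * ContinuousLinearMap.adjoint (creation η)
      = 0 := by
    change star (creation η) * star (creation η) = 0
    rw [← star_mul, h1, star_zero]
  rw [cliffordOperator, ← adjoint_creation_mul_add η, add_mul, mul_add, mul_add, h1, h2]
  abel

theorem Cliff.ι_mul_self (η : H) :
    Cliff.ι η * Cliff.ι η = algebraMap ℂ (Cliff H) ((‖η‖ ^ 2 : ℝ) : ℂ) := by
  refine Subtype.ext ?_
  refine (cliffordOperator_mul_self η).trans ?_
  exact (Algebra.algebraMap_eq_smul_one _).symm

/-- The spectrum of `η` in the Clifford algebra consists of `±‖η‖`. -/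
theorem Cliff.abs_re_of_mem_spectrum {η : H} {w : ℂ} (hw : w ∈ spectrum ℂ (Cliff.ι η)) :
    |w.re| = ‖η‖ := by
  have h := spectrum.pow_mem_pow (Cliff.ι η) 2 hw
  rw [pow_two (Cliff.ι η), Cliff.ι_mul_self] at h
  have hre := (Cliff.isSelfAdjoint_ι η).mem_spectrum_eq_re hw
  -- The spectrum of the scalar `‖η‖²` is a single point.
  have h' : w ^ 2 = ((‖η‖ ^ 2 : ℝ) : ℂ) := by
    by_contra hne
    refine h ?_
    change IsUnit (algebraMap ℂ (Cliff H) _ - algebraMap ℂ (Cliff H) _)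
    rw [← map_sub]
    exact (IsUnit.mk0 _ (sub_ne_zero.mpr hne)).map _
  rw [hre] at h'
  have h2 : w.re ^ 2 = ‖η‖ ^ 2 := by exact_mod_cast h'
  rw [← abs_norm η]
  exact (sq_eq_sq_iff_abs_eq_abs _ _).mp h2

/-- Functional calculus with an even function yields a scalar. -/
theorem Cliff.cfc_even (η : H) {f : ℝ → ℂ} (hf : ∀ s, f (-s) = f s) :
    cfc (fun w : ℂ => f w.re) (Cliff.ι η) = algebraMap ℂ (Cliff H) (f ‖η‖) := by
  have hn : IsStarNormal (Cliff.ι η) := (Cliff.isSelfAdjoint_ι η).isStarNormal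
  rw [← cfc_const (f ‖η‖) (Cliff.ι η) hn]
  refine cfc_congr fun w hw => ?_
  rw [← Cliff.abs_re_of_mem_spectrum hw]
  rcases abs_choice w.re with h | h <;> simp [h, hf]

theorem Cliff.norm_cfc_le (η : H) (f : ℝ → ℂ) {c : ℝ} (hc : 0 ≤ c)
    (h : ∀ s : ℝ, |s| = ‖η‖ → ‖f s‖ ≤ c) : ‖cfc (fun w : ℂ => f w.re) (Cliff.ι η)‖ ≤ c :=
  _root_.norm_cfc_le hc fun _ hw => h _ (Cliff.abs_re_of_mem_spectrum hw)

end Clifford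

/-! ### Logarithms and isometries -/

section Radius

variable {M : Type*} [MetricSpace M]

/-- The norm `√(d(x, x₀)² + t²)` of the Clifford vector `C_{x₀}(x, t)`. -/
def radius (x₀ : M) (z : M × ℝ≥0) : ℝ := √(dist z.1 x₀ ^ 2 + (z.2 : ℝ) ^ 2)

theorem radius_nonneg (x₀ : M) (z : M × ℝ≥0) : 0 ≤ radius x₀ z := Real.sqrt_nonneg _

theorem dist_le_radius (x₀ : M) (z : M × ℝ≥0) : dist z.1 x₀ ≤ radius x₀ z :=
  Real.le_sqrt_of_sq_le (by nlinarith [sq_nonneg (z.2 : ℝ)])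

theorem radius_le_add_dist (x₀ x₁ : M) (z : M × ℝ≥0) :
    radius x₁ z ≤ radius x₀ z + dist x₀ x₁ := by
  have h0 := dist_le_radius x₀ z
  have h1 := dist_triangle z.1 x₀ x₁
  have hr : radius x₀ z ^ 2 = dist z.1 x₀ ^ 2 + (z.2 : ℝ) ^ 2 := Real.sq_sqrt (by positivity)
  refine Real.sqrt_le_iff.mpr ⟨add_nonneg (radius_nonneg _ _) dist_nonneg, ?_⟩
  have h2 : dist z.1 x₁ ^ 2 ≤ (dist z.1 x₀ + dist x₀ x₁) ^ 2 := by gcongr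
  nlinarith [dist_nonneg (x := x₀) (y := x₁)]

end Radius

section Log

variable {M : Type u} [MetricSpace M] [HilbertHadamardSpace M]

theorem norm_log (x y : M) : ‖(log x y).toHilbert‖ = dist x y := by
  rw [← sub_zero (log x y).toHilbert, ← TangentCone.toHilbert_tip x, ← dist_eq_norm,
    TangentCone.dist_toHilbert]
  unfold log
  split_ifs with h
  · simp [h, TangentCone.coneDist]
  · rfl

/-- Geodesic segments in a CAT(0) space are unique: compare with a degenerate triangle. -/
theorem IsGeodesic.unique {x y : M} {c c' : unitInterval → M} (h : IsGeodesic x y c)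
    (h' : IsGeodesic x y c') : c = c' := by
  funext s
  have hd : dist (0 : EuclideanSpace ℝ (Fin 2)) (EuclideanSpace.single 0 (dist x y)) = dist x y := by
    rw [dist_zero_left, PiLp.norm_single, Real.norm_of_nonneg dist_nonneg]
  have key := HilbertHadamardSpace.cat0.2 x y y c c' h h' 0 (EuclideanSpace.single 0 (dist x y))
    (EuclideanSpace.single 0 (dist x y)) hd hd (by simp) s s
  rw [dist_self] at key
  exact dist_le_zero.mp key

theorem isometry_comp_geodesic (φ : M ≃ᵢ M) (x y : M) :
    (fun t => φ (geodesic x y t)) = geodesic (φ x) (φ y) := by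
  obtain ⟨h0, h1, h2⟩ := isGeodesic_geodesic x y
  refine IsGeodesic.unique ⟨congrArg φ h0, congrArg φ h1, fun s t => ?_⟩
    (isGeodesic_geodesic (φ x) (φ y))
  rw [φ.dist_eq, φ.dist_eq, h2]

theorem coneMap_log (φ : M ≃ᵢ M) {p q : M} (h : φ p = q) (y : M) :
    coneMap φ h (log p y) = log q (φ y) := by
  subst h
  unfold log
  by_cases hy : y = p
  · rw [dif_pos hy, dif_pos (congrArg φ hy)]
    rfl
  · rw [dif_neg hy, dif_neg (fun h => hy (φ.injective h))]
    simp only [coneMap, Equiv.coe_fn_mk, TangentCone.ray.injEq]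
    refine ⟨?_, (φ.isometry.nndist_eq p y).symm⟩
    simp only [GeodesicFrom.map, GeodesicFrom.of, isometry_comp_geodesic]

theorem tangentSumMap_mk (φ : M ≃ᵢ M) {p q : M} (h : φ p = q) (t : ℝ≥0) (v : TangentHilbert p) :
    tangentSumMap φ h t (TangentSum.mk v t) = TangentSum.mk (hilbertMap φ h v) t := rfl

theorem TangentSum.norm_mk {x : M} (v : TangentHilbert x) (t : ℝ≥0) :
    ‖TangentSum.mk v t‖ = √(‖v‖ ^ 2 + (t : ℝ) ^ 2) := by
  refine (WithLp.prod_norm_eq_of_L2 _).trans ?_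
  simp [TangentSum.mk]

theorem norm_cliffordMultiplier_vector (x₀ : M) (z : M × ℝ≥0) :
    ‖TangentSum.mk (-(log z.1 x₀).toHilbert) z.2‖ = radius x₀ z := by
  rw [TangentSum.norm_mk, norm_neg, norm_log, radius]

end Log

/-! ### Closed star subalgebras given by generators -/

section Generators

variable {A B C : Type*} [NonUnitalCStarAlgebra A] [NonUnitalCStarAlgebra B]
  [NonUnitalCStarAlgebra C] {s : Set A}

open scoped CStarAlgebra in
theorem map_mem_closure_adjoin (F : A →⋆ₙₐ[ℂ] A)
    (h : ∀ a ∈ s, F a ∈ (NonUnitalStarAlgebra.adjoin ℂ s).topologicalClosure) {a : A}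
    (ha : a ∈ (NonUnitalStarAlgebra.adjoin ℂ s).topologicalClosure) :
    F a ∈ (NonUnitalStarAlgebra.adjoin ℂ s).topologicalClosure := by
  let T := (NonUnitalStarAlgebra.adjoin ℂ s).topologicalClosure.comap F
  refine NonUnitalStarSubalgebra.topologicalClosure_minimal (t := T) _
    (NonUnitalStarAlgebra.adjoin_le h) ?_ ha
  exact (NonUnitalStarSubalgebra.isClosed_topologicalClosure _).preimage (map_continuous F)

open scoped CStarAlgebra in
theorem eqOn_closure_adjoin (F G : A →⋆ₙₐ[ℂ] A) (h : ∀ a ∈ s, F a = G a) {a : A}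
    (ha : a ∈ (NonUnitalStarAlgebra.adjoin ℂ s).topologicalClosure) : F a = G a := by
  refine NonUnitalStarSubalgebra.topologicalClosure_minimal
    (t := NonUnitalStarAlgHom.equalizer F G) _ (NonUnitalStarAlgebra.adjoin_le h) ?_ ha
  exact isClosed_eq (map_continuous F) (map_continuous G)

/-- For central self-adjoint contractions `eₙ`, the elements `a` with `eₙ a → a` form a closed star
subalgebra. So `eₙ` is an approximate unit as soon as it is one for the generators. -/
theorem tendsto_mul_of_mem_closure_adjoin {e : ℕ → A} (hnorm : ∀ n, ‖e n‖ ≤ 1)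
    (hstar : ∀ n, star (e n) = e n) (hcomm : ∀ n a, Commute (e n) a)
    (h : ∀ a ∈ s, Tendsto (fun n => e n * a) atTop (𝓝 a)) {a : A}
    (ha : a ∈ (NonUnitalStarAlgebra.adjoin ℂ s).topologicalClosure) :
    Tendsto (fun n => e n * a) atTop (𝓝 a) := by
  let S : NonUnitalStarSubalgebra ℂ A :=
    { carrier := {a | Tendsto (fun n => e n * a) atTop (𝓝 a)}
      add_mem' := fun {a b} ha hb => (ha.add hb).congr fun n => (mul_add _ _ _).symm
      zero_mem' := tendsto_const_nhds.congr fun n => (mul_zero _).symm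
      mul_mem' := fun {a b} ha _ => (ha.mul_const b).congr fun n => mul_assoc _ _ _
      smul_mem' := fun c a ha => (ha.const_smul c).congr fun n => (mul_smul_comm _ _ _).symm
      star_mem' := fun {a} ha => ha.star.congr fun n => by
        rw [star_mul, hstar, (hcomm n (star a)).eq] }
  refine NonUnitalStarSubalgebra.topologicalClosure_minimal (t := S) _
    (NonUnitalStarAlgebra.adjoin_le h) (isClosed_of_closure_subset fun a ha => ?_) ha
  refine Metric.tendsto_atTop.mpr fun ε hε => ?_
  obtain ⟨b, hb, hab⟩ := Metric.mem_closure_iff.mp ha (ε / 3) (by positivity)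
  obtain ⟨N, hN⟩ := Metric.tendsto_atTop.mp hb (ε / 3) (by positivity)
  refine ⟨N, fun n hn => ?_⟩
  have h1 : dist (e n * a) (e n * b) ≤ dist a b := by
    rw [dist_eq_norm, dist_eq_norm, ← mul_sub]
    exact (norm_mul_le _ _).trans (mul_le_of_le_one_left (norm_nonneg _) (hnorm n))
  have h2 := dist_triangle4 (e n * a) (e n * b) b a
  have h3 := hN n hn
  rw [dist_comm b a] at h2
  linarith

/-- A map that lifts a *-homomorphism through an injective *-homomorphism is a *-homomorphism. -/
def liftHom (i : B →⋆ₙₐ[ℂ] A) (hi : Function.Injective i) (k : C →⋆ₙₐ[ℂ] A) (f : C → B)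
    (hf : ∀ c, i (f c) = k c) : C →⋆ₙₐ[ℂ] B where
  toFun := f
  map_smul' r c := hi <| by
    rw [map_smul i, hf, hf, map_smul k]
    rfl
  map_zero' := hi <| by rw [hf, map_zero, map_zero]
  map_add' c d := hi <| by rw [hf, map_add k, map_add i, hf, hf]
  map_mul' c d := hi <| by rw [hf, map_mul k, map_mul i, hf, hf]
  map_star' c := hi <| by rw [hf, map_star k, map_star i, hf]

/-- *-endomorphisms `F g` of `A` that restrict to a subalgebra, and are there multiplicative in `g`,
define an action on this subalgebra. -/
def liftAction {G : Type*} [Group G] (i : B →⋆ₙₐ[ℂ] A) (hi : Function.Injective i)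
    (F : G → A →⋆ₙₐ[ℂ] A) (f : G → B → B) (hf : ∀ g b, i (f g b) = F g (i b))
    (h1 : ∀ b, F 1 (i b) = i b) (hmul : ∀ g h b, F (g * h) (i b) = F g (F h (i b))) :
    G →* (B ≃⋆ₐ[ℂ] B) where
  toFun g :=
    { toFun := f g
      invFun := f g⁻¹
      left_inv := fun b => hi <| by rw [hf, hf, ← hmul, inv_mul_cancel, h1]
      right_inv := fun b => hi <| by rw [hf, hf, ← hmul, mul_inv_cancel, h1]
      map_mul' := fun a b => hi <| by rw [hf, map_mul i, map_mul, map_mul i, hf, hf]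
      map_add' := fun a b => hi <| by rw [hf, map_add i, map_add, map_add i, hf, hf]
      map_star' := fun a => hi <| by rw [hf, map_star i, map_star, map_star i, hf]
      map_smul' := fun r a => hi <| by rw [hf, map_smul i, map_smul, map_smul i, hf] }
  map_one' := StarAlgEquiv.ext fun b => hi ((hf 1 b).trans (h1 b))
  map_mul' g h := StarAlgEquiv.ext fun b => hi <| by
    change i (f (g * h) b) = i (f g (f h b))
    rw [hf, hf, hf, hmul]

/-- A *-homomorphism with central values, as a homomorphism into the center. -/
def homToCenter (j : C →⋆ₙₐ[ℂ] B) (hj : ∀ c, j c ∈ Center B) : C →⋆ₙₐ[ℂ] Center B where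
  toFun c := ⟨j c, hj c⟩
  map_smul' r c := Subtype.ext (map_smul j r c)
  map_zero' := Subtype.ext (map_zero j)
  map_add' c d := Subtype.ext (map_add j c d)
  map_mul' c d := Subtype.ext (map_mul j c d)
  map_star' c := Subtype.ext (map_star j c)

end Generators

/-! ### Spectra of non-unital `C*`-algebras -/

section Spectrum

variable {B : Type*} [NonUnitalCStarAlgebra B]

/-- The bound `‖χ(b)‖² = ‖χ(b²)‖ ≤ ‖χ‖ ‖b‖²` improves `‖χ‖` to `√‖χ‖`. -/
theorem norm_character_le_one (χ : Spectrum B) :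
    ‖WeakDual.toStrongDual (χ : WeakDual ℂ B)‖ ≤ 1 := by
  set T := WeakDual.toStrongDual (χ : WeakDual ℂ B)
  have h : ∀ b, ‖T b‖ ≤ √‖T‖ * ‖b‖ := fun b => by
    refine abs_le_of_sq_le_sq' ?_ (by positivity) |>.2
    rw [mul_pow, Real.sq_sqrt (norm_nonneg T), pow_two, pow_two, ← norm_mul]
    have hm : T b * T b = T (b * b) := (χ.2.2 b b).symm
    rw [hm]
    exact (T.le_opNorm _).trans (by gcongr; exact norm_mul_le b b)
  have h' := T.opNorm_le_bound (Real.sqrt_nonneg _) h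
  by_contra! hlt
  have h1 := Real.sq_sqrt (norm_nonneg T)
  nlinarith

/-- The characters together with `0` form a weak-* compact set by the Banach–Alaoglu theorem, in
which the characters are open. -/
theorem locallyCompactSpace_spectrum : LocallyCompactSpace (Spectrum B) := by
  let K : Set (WeakDual ℂ B) := WeakDual.characterSpace ℂ B ∪ {0}
  have hK : IsCompact K := by
    refine (WeakDual.isCompact_closedBall (0 : StrongDual ℂ B) 1).of_isClosed_subset
      (WeakDual.CharacterSpace.union_zero_isClosed ℂ B) ?_
    rintro χ (hχ | rfl)
    · exact mem_closedBall_zero_iff.mpr (norm_character_le_one ⟨χ, hχ⟩)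
    · simp
  have : CompactSpace K := isCompact_iff_compactSpace.mp hK
  have hsub : WeakDual.characterSpace ℂ B ⊆ K := Set.subset_union_left
  refine (Topology.IsOpenEmbedding.mk (Topology.IsEmbedding.inclusion hsub) ?_).locallyCompactSpace
  have hr : Set.range (Set.inclusion hsub) = {χ : K | (χ : WeakDual ℂ B) ≠ 0} := by
    ext χ
    rw [Set.range_inclusion]
    exact ⟨fun h => h.1, fun h => χ.2.resolve_right h⟩
  rw [hr]
  exact isOpen_ne_fun continuous_subtype_val continuous_const

theorem Spectrum.exists_apply_ne_zero (χ : Spectrum B) : ∃ b, χ b ≠ 0 := by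
  by_contra! h
  exact χ.2.1 (DFunLike.ext _ _ h)

theorem Spectrum.exists_approxUnit_apply_ne_zero {e : ℕ → B}
    (he : ∀ b, Tendsto (fun n => e n * b) atTop (𝓝 b)) (χ : Spectrum B) : ∃ n, χ (e n) ≠ 0 := by
  by_contra! h
  obtain ⟨b, hb⟩ := Spectrum.exists_apply_ne_zero χ
  have h0 : ∀ n, χ (e n * b) = 0 := fun n => by rw [map_mul, h, zero_mul]
  have ht := ((map_continuous χ).tendsto b).comp (he b)
  exact hb (tendsto_nhds_unique (ht.congr h0) tendsto_const_nhds)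

open scoped CStarAlgebra in
/-- The pullback of characters along a *-homomorphism, defined if all pullbacks are nonzero. -/
def Spectrum.comap {C : Type*} [NonUnitalCStarAlgebra C] (j : C →⋆ₙₐ[ℂ] B)
    (hj : ∀ χ : Spectrum B, ∃ c, χ (j c) ≠ 0) (χ : Spectrum B) : Spectrum C :=
  ⟨StrongDual.toWeakDual
      { toFun := fun a => χ (j a)
        map_add' := fun a b => by rw [map_add, map_add]
        map_smul' := fun r a => by rw [map_smul, map_smul, RingHom.id_apply]
        cont := (map_continuous χ).comp (map_continuous j) },
    fun h => (hj χ).choose_spec (DFunLike.congr_fun h _), fun a b => by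
      change χ (j (a * b)) = χ (j a) * χ (j b)
      rw [map_mul, map_mul]⟩

theorem Spectrum.continuous_comap {C : Type*} [NonUnitalCStarAlgebra C] (j : C →⋆ₙₐ[ℂ] B)
    (hj : ∀ χ : Spectrum B, ∃ c, χ (j c) ≠ 0) : Continuous (Spectrum.comap j hj) :=
  Continuous.subtype_mk (WeakDual.continuous_of_continuous_eval fun a =>
    (WeakDual.eval_continuous (j a)).comp continuous_subtype_val) _

/-- If `E n` is a unit for `E m` whenever `m < n`, then on a compact set of characters some `E n` takes the
value `1`. If `χ` and `γ · χ` both lie in this set, then `E n` and `γ⁻¹ · E n` are not orthogonal, which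
holds for finitely many `γ` only. -/
theorem isProperAction_dualAction {Γ : Type*} [Group Γ] (ρ : Γ →* (B ≃⋆ₐ[ℂ] B)) {E : ℕ → B}
    (hE : ∀ m n, m < n → E n * E m = E m)
    (hlim : ∀ b, Tendsto (fun n => E n * b) atTop (𝓝 b))
    (hfin : ∀ n, {γ | E n * ρ γ (E n) ≠ 0}.Finite) : IsProperAction (dualAction ρ) := by
  intro K hK
  obtain ⟨t, ht⟩ := hK.elim_finite_subcover
    (fun n : ℕ => {χ : Spectrum B | χ (E n) ≠ 0})
    (fun n => isOpen_ne_fun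
      ((WeakDual.eval_continuous (E n)).comp continuous_subtype_val) continuous_const)
    (fun χ _ => Set.mem_iUnion.mpr (Spectrum.exists_approxUnit_apply_ne_zero hlim χ))
  have hone : ∀ χ ∈ K, χ (E (t.sup id + 1)) = 1 := fun χ hχ => by
    obtain ⟨m, hm, hne⟩ := Set.mem_iUnion₂.mp (ht hχ)
    have h1 := congrArg χ
      (hE m (t.sup id + 1) (Nat.lt_succ_of_le (Finset.le_sup (f := id) hm)))
    rw [map_mul] at h1
    exact mul_right_cancel₀ hne (h1.trans (one_mul _).symm)
  refine ((hfin (t.sup id + 1)).preimage inv_injective.injOn).subset ?_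
  rintro γ ⟨_, hχ, χ, hχ', rfl⟩ h0
  have h2 : χ (ρ γ⁻¹ (E (t.sup id + 1))) = 1 := hone _ hχ
  have h3 := congrArg χ h0
  rw [map_mul, hone χ hχ', h2, map_zero, one_mul] at h3
  exact one_ne_zero h3

/-- Central elements `E n` in the image of `C` that form an approximate unit for `B`, and are almost
orthogonal to their translates, make `B` a proper `C*`-algebra over the spectrum of `C`. The
approximate unit ensures that characters of the center of `B` remain nonzero on `C`. -/
theorem exists_isProperCStarAlgebraOver {Γ C : Type*} [Group Γ] [NonUnitalCStarAlgebra C]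
    (ρ : Γ →* (B ≃⋆ₐ[ℂ] B)) (ρC : Γ →* (C ≃⋆ₐ[ℂ] C)) (j : C →⋆ₙₐ[ℂ] B)
    (hj : ∀ c, j c ∈ Center B) (hρ : ∀ γ c, j (ρC γ c) = ρ γ (j c)) {E : ℕ → C}
    (hE : ∀ m n, m < n → E n * E m = E m)
    (hlimC : ∀ c, Tendsto (fun n => E n * c) atTop (𝓝 c))
    (hlim : ∀ b, Tendsto (fun n => j (E n) * b) atTop (𝓝 b))
    (hfin : ∀ n, {γ | E n * ρC γ (E n) ≠ 0}.Finite) :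
    ∃ π : Spectrum (Center B) → Spectrum C, (∀ χ c, π χ c = χ (homToCenter j hj c)) ∧
      IsProperCStarAlgebraOver ρ (dualAction ρC) π := by
  have hchar : ∀ χ : Spectrum (Center B), ∃ c, χ (homToCenter j hj c) ≠ 0 := fun χ => by
    obtain ⟨n, hn⟩ := Spectrum.exists_approxUnit_apply_ne_zero
      (e := fun n => homToCenter j hj (E n)) (fun z => tendsto_subtype_rng.mpr (hlim z)) χ
    exact ⟨E n, hn⟩
  exact ⟨Spectrum.comap (homToCenter j hj) hchar, fun _ _ => rfl,
    { t2 := inferInstance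
      locallyCompact := locallyCompactSpace_spectrum
      continuous := Spectrum.continuous_comap _ _
      equivariant := fun γ χ => WeakDual.CharacterSpace.ext fun c =>
        congrArg χ (Subtype.ext (hρ γ⁻¹ c).symm)
      proper := isProperAction_dualAction _ hE hlimC hfin }⟩

theorem dense_span_mul {C : Type*} {j : C → B} {E : ℕ → C}
    (hlim : ∀ b, Tendsto (fun n => j (E n) * b) atTop (𝓝 b)) :
    Dense (Submodule.span ℂ {b : B | ∃ c b', j c * b' = b} : Set B) := fun b =>
  mem_closure_of_tendsto (hlim b)
    (Eventually.of_forall fun n => Submodule.subset_span ⟨E n, b, rfl⟩)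

end Spectrum

/-! ### Bott elements -/

section Bott

variable {M : Type u} [MetricSpace M] [HilbertHadamardSpace M]

/-- Even functions of `C_{x₀}` are scalar-valued, since `C_{x₀}² = d(·, x₀)² + t²`. -/
theorem bott_apply_of_even (x₀ : M) {f : C₀(ℝ, ℂ)} (hf : ∀ s, f (-s) = f s) (z : M × ℝ≥0) :
    (bott x₀ f : PiAlg M) z = algebraMap ℂ _ (f (radius x₀ z)) := by
  rw [← norm_cliffordMultiplier_vector]
  exact Cliff.cfc_even _ hf

theorem norm_bott_apply_le (x₀ : M) (f : C₀(ℝ, ℂ)) (z : M × ℝ≥0) {c : ℝ} (hc : 0 ≤ c)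
    (h : ∀ s : ℝ, |s| = radius x₀ z → ‖f s‖ ≤ c) : ‖(bott x₀ f : PiAlg M) z‖ ≤ c := by
  rw [← norm_cliffordMultiplier_vector] at h
  exact Cliff.norm_cfc_le _ f hc h

theorem map_cliffordMultiplier (φ : M ≃ᵢ M) (x₀ : M) (z : M × ℝ≥0) :
    Cliff.map (tangentSumMap φ (φ.apply_symm_apply z.1) z.2)
      (cliffordMultiplier x₀ (φ.symm z.1, z.2)) = cliffordMultiplier (φ x₀) z := by
  unfold cliffordMultiplier
  rw [Cliff.map_ι, tangentSumMap_mk, map_neg, hilbertMap_toHilbert, coneMap_log]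

theorem pushforward_bott (φ : M ≃ᵢ M) (x₀ : M) (f : C₀(ℝ, ℂ)) :
    pushforward φ (bott x₀ f) = bott (φ x₀) f := by
  ext z
  change Cliff.map (tangentSumMap φ (φ.apply_symm_apply z.1) z.2)
    (cfc (fun w : ℂ => f w.re) (cliffordMultiplier x₀ (φ.symm z.1, z.2)))
    = cfc (fun w : ℂ => f w.re) (cliffordMultiplier (φ x₀) z)
  have h1 := isStarNormal_cliffordMultiplier x₀ (φ.symm z.1, z.2)
  have h2 := isStarNormal_cliffordMultiplier (φ x₀) z
  rw [← map_cliffordMultiplier φ x₀ z] at h2 ⊢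
  exact StarAlgHomClass.map_cfc (Cliff.map (tangentSumMap φ (φ.apply_symm_apply z.1) z.2))
    (fun w : ℂ => f w.re) (cliffordMultiplier x₀ (φ.symm z.1, z.2)) (by fun_prop)
    (StarAlgEquiv.isometry _).continuous h1 h2

theorem bott_mem_algA (x₀ : M) (f : C₀(ℝ, ℂ)) : bott x₀ f ∈ algA M :=
  NonUnitalStarSubalgebra.le_topologicalClosure _
    (NonUnitalStarAlgebra.subset_adjoin ℂ _ ⟨x₀, f, rfl⟩)

theorem bott_mem_algAev (x₀ : M) {f : C₀(ℝ, ℂ)} (hf : ∀ s, f (-s) = f s) :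
    bott x₀ f ∈ algAev M :=
  NonUnitalStarSubalgebra.le_topologicalClosure _
    (NonUnitalStarAlgebra.subset_adjoin ℂ _ ⟨x₀, f, hf, rfl⟩)

theorem commute_of_mem_algAev {a : PiB M} (ha : a ∈ algAev M) (b : PiB M) : Commute a b := by
  have h : algAev M ≤ Center (PiB M) := by
    refine NonUnitalStarSubalgebra.topologicalClosure_minimal _
      (NonUnitalStarAlgebra.adjoin_le ?_) isClosed_center
    rintro _ ⟨x₀, f, hf, rfl⟩
    change _ ∈ Center (PiB M)
    rw [NonUnitalStarSubalgebra.mem_center_iff]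
    intro b
    ext z
    change b z * (bott x₀ f : PiAlg M) z = (bott x₀ f : PiAlg M) z * b z
    rw [bott_apply_of_even x₀ hf]
    exact (Algebra.commutes _ _).symm
  exact ((NonUnitalStarSubalgebra.mem_center_iff).mp (h ha) b).symm

end Bott

/-! ### Cutoff functions and an approximate unit -/

section Cutoff

/-- The even cutoff function that is `1` on `[-r, r]` and `0` off `(-r - 1, r + 1)`. -/
def cutoff (r : ℝ) : C₀(ℝ, ℂ) where
  toFun s := ((max 0 (min 1 (r + 1 - |s|)) : ℝ) : ℂ)
  continuous_toFun := by fun_prop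
  zero_at_infty' := by
    refine tendsto_const_nhds.congr' ?_
    filter_upwards [(isCompact_closedBall (0 : ℝ) (r + 1)).compl_mem_cocompact] with s hs
    have hs' : r + 1 < |s| := by simpa using hs
    rw [max_eq_left ((min_le_right _ _).trans (by linarith)), Complex.ofReal_zero]

theorem cutoff_apply (r s : ℝ) :
    cutoff r s = ((max 0 (min 1 (r + 1 - |s|)) : ℝ) : ℂ) := rfl

theorem cutoff_neg (r s : ℝ) : cutoff r (-s) = cutoff r s := by
  rw [cutoff_apply, cutoff_apply, abs_neg]

theorem cutoff_eq_one {r s : ℝ} (h : |s| ≤ r) : cutoff r s = 1 := by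
  rw [cutoff_apply, min_eq_left (by linarith), max_eq_right zero_le_one, Complex.ofReal_one]

theorem cutoff_eq_zero {r s : ℝ} (h : r + 1 ≤ |s|) : cutoff r s = 0 := by
  rw [cutoff_apply, max_eq_left ((min_le_right _ _).trans (by linarith)), Complex.ofReal_zero]

theorem norm_cutoff_le (r s : ℝ) : ‖cutoff r s‖ ≤ 1 := by
  rw [cutoff_apply, Complex.norm_real, Real.norm_of_nonneg (le_max_left _ _)]
  exact max_le zero_le_one (min_le_left _ _)

theorem norm_cutoff_sub_one_le (r s : ℝ) : ‖cutoff r s - 1‖ ≤ 1 := by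
  rw [cutoff_apply, ← Complex.ofReal_one, ← Complex.ofReal_sub, Complex.norm_real,
    Real.norm_eq_abs, abs_le]
  have h0 : (0 : ℝ) ≤ max 0 (min 1 (r + 1 - |s|)) := le_max_left _ _
  have h1 : max 0 (min 1 (r + 1 - |s|)) ≤ 1 := max_le zero_le_one (min_le_left _ _)
  constructor <;> linarith

/-- The cutoff at `r + 1` is a unit for the cutoff at `r`. -/
theorem cutoff_mul_cutoff {r r' : ℝ} (h : r + 1 ≤ r') : cutoff r' * cutoff r = cutoff r := by
  ext s
  rw [ZeroAtInftyContinuousMap.mul_apply]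
  by_cases hs : r + 1 ≤ |s|
  · rw [cutoff_eq_zero hs, mul_zero]
  · rw [cutoff_eq_one (by linarith), one_mul]

theorem star_cutoff (r : ℝ) : star (cutoff r) = cutoff r := by
  ext s
  exact Complex.conj_ofReal _

variable {M : Type u} [MetricSpace M] [HilbertHadamardSpace M]

theorem norm_bott_cutoff_le (x₀ : M) (r : ℝ) : ‖bott x₀ (cutoff r)‖ ≤ 1 :=
  lp.norm_le_of_forall_le zero_le_one fun z =>
    norm_bott_apply_le x₀ _ z zero_le_one fun s _ => norm_cutoff_le r s

/-- Bott elements of cutoff functions with far apart base points are orthogonal, as their supports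
are disjoint. -/
theorem bott_cutoff_mul_eq_zero (x₀ x₁ : M) {r : ℝ} (h : 2 * (r + 1) ≤ dist x₀ x₁) :
    bott x₀ (cutoff r) * bott x₁ (cutoff r) = 0 := by
  ext z
  change (bott x₀ (cutoff r) : PiAlg M) z * (bott x₁ (cutoff r) : PiAlg M) z = 0
  rw [bott_apply_of_even x₀ (cutoff_neg r), bott_apply_of_even x₁ (cutoff_neg r), ← map_mul]
  have h0 := dist_le_radius x₀ z
  have h1 := dist_le_radius x₁ z
  have h2 := dist_triangle_left x₀ x₁ z.1
  rcases le_total (r + 1) (radius x₀ z) with h3 | h3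
  · rw [cutoff_eq_zero (h3.trans (le_abs_self _)), zero_mul, map_zero]
  · rw [cutoff_eq_zero ((show r + 1 ≤ radius x₁ z by linarith).trans (le_abs_self _)), mul_zero,
      map_zero]

theorem tendsto_bott_cutoff_mul_bott (x₀ x₁ : M) (f : C₀(ℝ, ℂ)) :
    Tendsto (fun n : ℕ => bott x₀ (cutoff n) * bott x₁ f) atTop (𝓝 (bott x₁ f)) := by
  rw [Metric.tendsto_atTop]
  intro ε hε
  have hf : ∀ᶠ s in cocompact ℝ, ‖f s‖ < ε / 2 :=
    (tendsto_zero_iff_norm_tendsto_zero.mp f.zero_at_infty').eventually_lt_const (half_pos hε)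
  obtain ⟨R, hR⟩ := (Metric.closedBall_compl_subset_of_mem_cocompact hf 0)
  -- Where `‖C_{x₁}‖ ≤ R` the cutoff is `1`, as `‖C_{x₀}‖ ≤ R + d(x₁, x₀)`; elsewhere `f` is small.
  obtain ⟨N, hN⟩ := exists_nat_ge (R + dist x₁ x₀)
  refine ⟨N, fun n hn => ?_⟩
  rw [dist_eq_norm]
  refine (lp.norm_le_of_forall_le (half_pos hε).le fun z => ?_).trans_lt (half_lt_self hε)
  change ‖(bott x₀ (cutoff n) : PiAlg M) z * (bott x₁ f : PiAlg M) z - (bott x₁ f : PiAlg M) z‖ ≤ _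
  rw [bott_apply_of_even x₀ (cutoff_neg n), ← Algebra.smul_def,
    show ∀ (c : ℂ) (v : Cliff (TangentSum z.1 z.2)), c • v - v = (c - 1) • v from
      fun c v => by rw [sub_smul, one_smul]]
  have hr := radius_le_add_dist x₁ x₀ z
  rcases le_or_gt (radius x₁ z) R with hz | hz
  · have hn' : (N : ℝ) ≤ n := by exact_mod_cast hn
    rw [cutoff_eq_one (by rw [abs_of_nonneg (radius_nonneg _ _)]; linarith), sub_self, zero_smul,
      norm_zero]
    exact (half_pos hε).le
  · rw [norm_smul]
    refine (mul_le_of_le_one_left (norm_nonneg _) (norm_cutoff_sub_one_le _ _)).trans ?_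
    refine norm_bott_apply_le x₁ f z (half_pos hε).le fun s hs => le_of_lt (hR ?_)
    simpa [hs] using hz

theorem tendsto_bott_cutoff_mul (x₀ : M) {a : PiB M} (ha : a ∈ algA M) :
    Tendsto (fun n : ℕ => bott x₀ (cutoff n) * a) atTop (𝓝 a) := by
  refine tendsto_mul_of_mem_closure_adjoin (e := fun n : ℕ => bott x₀ (cutoff n))
    (fun n => norm_bott_cutoff_le x₀ n) (fun n => ?_)
    (fun n => commute_of_mem_algAev (bott_mem_algAev x₀ (cutoff_neg n))) ?_ ha
  · rw [← map_star, star_cutoff]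
  · rintro _ ⟨x₁, f, rfl⟩
    exact tendsto_bott_cutoff_mul_bott x₀ x₁ f

end Cutoff

/-! ### The induced actions and the restriction of characters -/

section Action

variable {M : Type u} [MetricSpace M] [HilbertHadamardSpace M]

theorem pushforward_mem_algA (φ : M ≃ᵢ M) {a : PiB M} (ha : a ∈ algA M) :
    pushforward φ a ∈ algA M := by
  refine map_mem_closure_adjoin (pushforward φ) ?_ ha
  rintro _ ⟨x₀, f, rfl⟩
  rw [pushforward_bott]
  exact bott_mem_algA _ _

theorem pushforward_mem_algAev (φ : M ≃ᵢ M) {a : PiB M} (ha : a ∈ algAev M) :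
    pushforward φ a ∈ algAev M := by
  refine map_mem_closure_adjoin (pushforward φ) ?_ ha
  rintro _ ⟨x₀, f, hf, rfl⟩
  rw [pushforward_bott]
  exact bott_mem_algAev _ hf

theorem pushforward_one {a : PiB M} (ha : a ∈ algA M) :
    pushforward (1 : M ≃ᵢ M) a = a := by
  refine eqOn_closure_adjoin (pushforward 1) (NonUnitalStarAlgHom.id ℂ (PiB M)) ?_ ha
  rintro _ ⟨x₀, f, rfl⟩
  exact pushforward_bott 1 x₀ f

theorem pushforward_mul (φ ψ : M ≃ᵢ M) {a : PiB M} (ha : a ∈ algA M) :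
    pushforward (φ * ψ) a = pushforward φ (pushforward ψ a) := by
  refine eqOn_closure_adjoin (pushforward (φ * ψ)) ((pushforward φ).comp (pushforward ψ)) ?_ ha
  rintro _ ⟨x₀, f, rfl⟩
  rw [NonUnitalStarAlgHom.comp_apply, pushforward_bott, pushforward_bott, pushforward_bott]
  rfl

theorem BottAlgebra.incl_injective : Function.Injective (BottAlgebra.incl (M := M)) :=
  Subtype.val_injective

theorem EvenBottAlgebra.incl_injective : Function.Injective (EvenBottAlgebra.incl (M := M)) :=
  Subtype.val_injective

theorem BottAlgebra.incl_mem (a : BottAlgebra M) : BottAlgebra.incl a ∈ algA M := a.2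

theorem EvenBottAlgebra.incl_mem (a : EvenBottAlgebra M) : EvenBottAlgebra.incl a ∈ algAev M := a.2

/-- An element of `A(M)`, as an element of the type `BottAlgebra M`. -/
def BottAlgebra.mk (a : PiB M) (ha : a ∈ algA M) : BottAlgebra M := (⟨a, ha⟩ : algA M)

/-- An element of `A_ev(M)`, as an element of the type `EvenBottAlgebra M`. -/
def EvenBottAlgebra.mk (a : PiB M) (ha : a ∈ algAev M) : EvenBottAlgebra M := (⟨a, ha⟩ : algAev M)

theorem BottAlgebra.incl_mk (a : PiB M) (ha : a ∈ algA M) :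
    BottAlgebra.incl (BottAlgebra.mk a ha) = a := rfl

theorem EvenBottAlgebra.incl_mk (a : PiB M) (ha : a ∈ algAev M) :
    EvenBottAlgebra.incl (EvenBottAlgebra.mk a ha) = a := rfl

theorem BottAlgebra.tendsto_iff {u : ℕ → BottAlgebra M} {a : BottAlgebra M} :
    Tendsto u atTop (𝓝 a) ↔ Tendsto (fun n => (u n).incl) atTop (𝓝 a.incl) :=
  tendsto_subtype_rng

theorem EvenBottAlgebra.tendsto_iff {u : ℕ → EvenBottAlgebra M} {a : EvenBottAlgebra M} :
    Tendsto u atTop (𝓝 a) ↔ Tendsto (fun n => (u n).incl) atTop (𝓝 a.incl) :=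
  tendsto_subtype_rng

variable (M) in
/-- The action of the isometry group on `A(M)`. -/
def bottAction : (M ≃ᵢ M) →* (BottAlgebra M ≃⋆ₐ[ℂ] BottAlgebra M) :=
  liftAction BottAlgebra.incl BottAlgebra.incl_injective pushforward
    (fun φ a => .mk _ (pushforward_mem_algA φ a.incl_mem)) (fun _ _ => BottAlgebra.incl_mk _ _)
    (fun a => pushforward_one a.incl_mem) (fun φ ψ a => pushforward_mul φ ψ a.incl_mem)

variable (M) in
/-- The action of the isometry group on `A_ev(M)`. -/
def evenBottAction : (M ≃ᵢ M) →* (EvenBottAlgebra M ≃⋆ₐ[ℂ] EvenBottAlgebra M) :=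
  liftAction EvenBottAlgebra.incl EvenBottAlgebra.incl_injective pushforward
    (fun φ a => .mk _ (pushforward_mem_algAev φ a.incl_mem))
    (fun _ _ => EvenBottAlgebra.incl_mk _ _)
    (fun a => pushforward_one (algAev_le_algA a.incl_mem))
    (fun φ ψ a => pushforward_mul φ ψ (algAev_le_algA a.incl_mem))

theorem incl_bottAction (φ : M ≃ᵢ M) (a : BottAlgebra M) :
    BottAlgebra.incl (bottAction M φ a) = pushforward φ (BottAlgebra.incl a) :=
  BottAlgebra.incl_mk _ _

theorem incl_evenBottAction (φ : M ≃ᵢ M) (a : EvenBottAlgebra M) :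
    EvenBottAlgebra.incl (evenBottAction M φ a) = pushforward φ (EvenBottAlgebra.incl a) :=
  EvenBottAlgebra.incl_mk _ _

variable (M) in
/-- The inclusion of `A_ev(M)` into `A(M)`. -/
def evenToBott : EvenBottAlgebra M →⋆ₙₐ[ℂ] BottAlgebra M :=
  liftHom BottAlgebra.incl BottAlgebra.incl_injective EvenBottAlgebra.incl
    (fun a => .mk a.incl (algAev_le_algA a.incl_mem)) (fun _ => BottAlgebra.incl_mk _ _)

theorem incl_evenToBott (a : EvenBottAlgebra M) :
    BottAlgebra.incl (evenToBott M a) = EvenBottAlgebra.incl a :=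
  BottAlgebra.incl_mk _ _

theorem evenToBott_mem_center (a : EvenBottAlgebra M) :
    evenToBott M a ∈ Center (BottAlgebra M) := by
  refine NonUnitalStarSubalgebra.mem_center_iff.mpr fun b => BottAlgebra.incl_injective ?_
  rw [map_mul, map_mul, incl_evenToBott]
  exact (commute_of_mem_algAev a.incl_mem b.incl).symm.eq

variable (M) in
/-- The inclusion of `A_ev(M)` into the center of `A(M)`. -/
def evenToCenter : EvenBottAlgebra M →⋆ₙₐ[ℂ] Center (BottAlgebra M) :=
  homToCenter (evenToBott M) evenToBott_mem_center

theorem incl_evenToCenter (a : EvenBottAlgebra M) :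
    BottAlgebra.incl (evenToCenter M a : BottAlgebra M) = EvenBottAlgebra.incl a :=
  incl_evenToBott a

theorem evenToBott_evenBottAction (φ : M ≃ᵢ M) (a : EvenBottAlgebra M) :
    evenToBott M (evenBottAction M φ a) = bottAction M φ (evenToBott M a) :=
  BottAlgebra.incl_injective <| by
    rw [incl_evenToBott, incl_evenBottAction, incl_bottAction, incl_evenToBott]

/-- The elements `β_{x₀}(cutoff n)` form an approximate unit for `A(M)` inside `A_ev(M)`, with each
term a unit for the preceding ones, and almost all translates of a term under a metrically proper
action are orthogonal to it. If `M` is empty, the algebras vanish. -/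
theorem exists_even_approxUnit {Γ : Type*} [Group Γ] (α : Γ →* (M ≃ᵢ M))
    (hα : IsMetricallyProper α) : ∃ e : ℕ → EvenBottAlgebra M,
      (∀ m n, m < n → e n * e m = e m) ∧
      (∀ a, Tendsto (fun n => e n * a) atTop (𝓝 a)) ∧
      (∀ a, Tendsto (fun n => evenToBott M (e n) * a) atTop (𝓝 a)) ∧
      ∀ n, {γ | e n * evenBottAction M (α γ) (e n) ≠ 0}.Finite := by
  rcases isEmpty_or_nonempty M with hM | ⟨⟨x₀⟩⟩
  · have hs : Subsingleton (PiB M) := ⟨fun a b => lp.ext (Subsingleton.elim _ _)⟩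
    have h1 : Subsingleton (BottAlgebra M) := BottAlgebra.incl_injective.subsingleton
    have h2 : Subsingleton (EvenBottAlgebra M) := EvenBottAlgebra.incl_injective.subsingleton
    refine ⟨0, fun _ _ _ => mul_zero _, fun a => ?_, fun a => ?_, fun n => ?_⟩
    · exact tendsto_const_nhds.congr fun n => Subsingleton.elim _ _
    · exact tendsto_const_nhds.congr fun n => Subsingleton.elim _ _
    · simp
  let e : ℕ → EvenBottAlgebra M := fun n => .mk _ (bott_mem_algAev x₀ (cutoff_neg n))
  have he : ∀ n, (e n).incl = bott x₀ (cutoff n) := fun n => EvenBottAlgebra.incl_mk _ _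
  refine ⟨e, fun m n hmn => EvenBottAlgebra.incl_injective ?_, fun a => ?_, fun a => ?_, fun n => ?_⟩
  · rw [map_mul, he, he, ← map_mul, cutoff_mul_cutoff (by exact_mod_cast hmn)]
  · refine EvenBottAlgebra.tendsto_iff.mpr
      ((tendsto_bott_cutoff_mul x₀ (algAev_le_algA a.incl_mem)).congr fun n => ?_)
    rw [map_mul, he]
  · refine BottAlgebra.tendsto_iff.mpr
      ((tendsto_bott_cutoff_mul x₀ a.incl_mem).congr fun n => ?_)
    rw [map_mul, incl_evenToBott, he]
  · have hfin : {γ : Γ | ¬ 2 * ((n : ℝ) + 1) ≤ dist x₀ (α γ x₀)}.Finite :=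
      (hα x₀).eventually_ge_atTop (2 * ((n : ℝ) + 1))
    refine hfin.subset fun γ hγ hd => hγ (EvenBottAlgebra.incl_injective ?_)
    rw [map_mul, incl_evenBottAction, he, pushforward_bott, bott_cutoff_mul_eq_zero x₀ _ hd,
      map_zero]

end Action

end HilbertHadamard

end

open HilbertHadamard in
theorem proposition7 {Γ : Type*} [Group Γ] {M : Type*} [MetricSpace M] [HilbertHadamardSpace M]
    (α : Γ →* (M ≃ᵢ M)) (hα : IsMetricallyProper α) :
    ∃ (ρ : Γ →* (BottAlgebra M ≃⋆ₐ[ℂ] BottAlgebra M))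
      (ρev : Γ →* (EvenBottAlgebra M ≃⋆ₐ[ℂ] EvenBottAlgebra M))
      (j : EvenBottAlgebra M →⋆ₙₐ[ℂ] Center (BottAlgebra M))
      (π : Spectrum (Center (BottAlgebra M)) → Spectrum (EvenBottAlgebra M)),
      (∀ γ a, BottAlgebra.incl (ρ γ a) = pushforward (α γ) (BottAlgebra.incl a)) ∧
      (∀ γ a, EvenBottAlgebra.incl (ρev γ a) = pushforward (α γ) (EvenBottAlgebra.incl a)) ∧
      (∀ a, BottAlgebra.incl (j a : BottAlgebra M) = EvenBottAlgebra.incl a) ∧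
      Dense (Submodule.span ℂ {c : BottAlgebra M | ∃ a b, (j a : BottAlgebra M) * b = c} :
        Set (BottAlgebra M)) ∧
      (∀ χ a, π χ a = χ (j a)) ∧
      IsProperCStarAlgebraOver ρ (dualAction ρev) π := by
  obtain ⟨e, hone, hlim_ev, hlim, hfin⟩ := exists_even_approxUnit α hα
  obtain ⟨π, hπ, hproper⟩ := exists_isProperCStarAlgebraOver ((bottAction M).comp α)
    ((evenBottAction M).comp α) (evenToBott M) evenToBott_mem_center
    (fun γ => evenToBott_evenBottAction (α γ)) hone hlim_ev hlim hfin
  exact ⟨(bottAction M).comp α, (evenBottAction M).comp α, evenToCenter M, π,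
    fun γ => incl_bottAction (α γ), fun γ => incl_evenBottAction (α γ), incl_evenToCenter,
    dense_span_mul hlim, hπ, hproper⟩
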